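/- Let $d\ge 2$, $l\ge 1$, $n=3d$. A rational plane tropical curve $C=(\Gamma,x_1,\dots,x_n,h)$ of degree $d$ with $n$ markings consists of a metric tree $\Gamma$ with bounded and unbounded edges, all vertices having valence at least $3$, of distinct unbounded edges $x_1,\dots,x_n$, and of a continuous map $h:\Gamma\to\mathbb R^2$ which is affine with an integral direction vector on every edge, is balanced at every vertex, contracts every $x_i$ to a point, and has on the other unbounded edges the directions $(-1,0),(0,-1),(1,1)$, each exactly $d$ times. Let $\mathcal L^l\subset\mathbb R^2$ be a tropical plane curve of degree $l$, i.e. the set of points where $\max_{i+j\le l}(a_{ij}+ix+jy)$ is attained at least twice, with real coefficients $a_{ij}$. Let $\mathcal M_4$ be the space of abstract $4$-marked rational tropical curves; a curve of type (A) with length $t>0$ has one bounded edge, of length $t$, which separates $x_1,x_2$ from $x_3,x_4$. On the space of curves $C$ as above with $h(x_1),h(x_2)\in\mathcal L^l$, consider the map $$\tilde\pi=ev_3\times\dots\times ev_n\times\delta,\qquad \tilde\pi(C)=(h(x_3),\dots,h(x_n),\delta(C))\in\mathbb R^{2n-4}\times\mathcal M_4,$$ where $\delta$ forgets $h$ and all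 unbounded edges except $x_1,\dots,x_4$. Call $C$ general if $\Gamma$ is trivalent and $h(x_1),h(x_2)$ lie in the relative interiors of edges of $\mathcal L^l$. (If $P$ is in $\tilde\pi$-general position, all curves in $\tilde\pi^{-1}(P)$ are general by definition.) For a general $C$ the multiplicity $\operatorname{mult}_C(\tilde\pi)$ is the absolute value of the determinant of the square matrix of size $2n-1$, in the position of a root vertex and the lengths of the bounded edges, whose rows are the coordinates of $h(x_3),\dots,h(x_n)$, the length of the bounded edge of $\delta(C)$, and, for $i=1,2$, the evaluation at $x_i$ in the direction of the integral normal vector of the edge of $\mathcal L^l$ through $h(x_i)$, of lattice length the weight of this edge. Let $p_3,\dots,p_n\in\mathbb R^2$. There is a real number $R$, which may depend on $d$, $\mathcal L^l$ and $p_3,\dots,p_n$, such that the following holds for every $z\in\mathcal M_4$ of type (A) with length $t>R$, with $P=(p_3,\dots,p_n,z)$. Every general curve $C\in\tilde\pi^{-1}(P)$ with $\operatorname{mult}_C(\tilde\pi)\ne 0$ satisfies at least one of the following. (a) The markings $x_1$ and $x_2$ are adjacent to the same vertex. (b) $C$ decomposes uniquely into two components $C_1$ and $C_2$: it has exactly one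 contracted bounded edge $E$, and splitting $C$ at $E$ (so that $E$ becomes a contracted unbounded edge on both sides) gives plane tropical curves $C_1$, $C_2$ of degrees $d_1,d_2\ge1$ with $d_1+d_2=d$, such that $x_1,x_2$ are on $C_1$, $x_3,x_4$ are on $C_2$, and exactly $3d_1-1$ of the markings $x_5,\dots,x_{3d}$ are on $C_1$. -/

import Mathlib

open scoped BigOperators

namespace PlaneTropical

noncomputable section

open Classical in
/-- A plane tropical curve of genus zero whose marked (contracted) unbounded edges are indexed by `I`.

The underlying metric graph is given by its vertices, its bounded edges (the edges of a tree on the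
vertices, with lengths), its marked unbounded edges (attached at `mark i`) and its remaining unbounded
edges (attached at `endAt u`).  The map to the plane is affine on each edge with integral slope: it is
given by the images `pos v` of the vertices, by the direction vectors `dir v w` of the flags at `v` in
the bounded edge from `v` to `w`, and by the direction vectors of the unmarked unbounded edges; marked
edges are contracted, so that they have direction `0`.  The values of `len` and `dir` matter on edges
only. -/
structure PlaneTropicalCurve (I : Type) [Fintype I] where
  /-- vertices -/
  V : Type
  [fintypeV : Fintype V]
  /-- unmarked unbounded edges -/
  U : Type
  [fintypeU : Fintype U]
  /-- bounded edges -/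
  graph : SimpleGraph V
  isTree : graph.IsTree
  len : Sym2 V → ℝ
  len_pos : ∀ e ∈ graph.edgeSet, 0 < len e
  mark : I → V
  endAt : U → V
  endDir : U → Fin 2 → ℤ
  pos : V → Fin 2 → ℝ
  dir : V → V → Fin 2 → ℤ
  pos_sub : ∀ v w, graph.Adj v w → ∀ j, pos w j - pos v j = len s(v, w) * (dir v w j : ℝ)
  balanced : ∀ v, (∑ w, if graph.Adj v w then dir v w else 0)
    + (∑ u, if endAt u = v then endDir u else 0) = 0
  three_le_valence : ∀ v, 3 ≤ (∑ w, if graph.Adj v w then 1 else 0)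
    + (∑ u, if endAt u = v then 1 else 0) + (∑ i, if mark i = v then 1 else 0)

attribute [instance] PlaneTropicalCurve.fintypeV PlaneTropicalCurve.fintypeU

/-- The degree of a plane curve of degree `d`: each of `(-1,0)`, `(0,-1)`, `(1,1)` taken `d` times. -/
def standardDegree (d : ℕ) : Multiset (Fin 2 → ℤ) :=
  Multiset.replicate d ![-1, 0] + Multiset.replicate d ![0, -1] + Multiset.replicate d ![1, 1]

namespace PlaneTropicalCurve

variable {I : Type} [Fintype I] (C : PlaneTropicalCurve I)

/-- The multiset of directions of the unmarked unbounded edges. -/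
def degree : Multiset (Fin 2 → ℤ) := Finset.univ.val.map C.endDir

/-- The evaluation at the `i`-th marking. -/
def ev (i : I) : Fin 2 → ℝ := C.pos (C.mark i)

open Classical in
/-- The number of flags at a vertex. -/
def valence (v : C.V) : ℕ := (∑ w, if C.graph.Adj v w then 1 else 0)
  + (∑ u, if C.endAt u = v then 1 else 0) + (∑ i, if C.mark i = v then 1 else 0)

/-- The combinatorial type has codimension `∑ v, (valence v - 3) = 0`. -/
def IsTrivalent : Prop := ∀ v, C.valence v = 3

/-! ### Splitting a curve at a contracted bounded edge -/

/-- A contracted bounded edge, together with an orientation (from `fst` to `snd`). -/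
structure ContractedEdge where
  fst : C.V
  snd : C.V
  adj : C.graph.Adj fst snd
  dir_eq_zero : C.dir fst snd = 0

variable {C}

/-- The vertices on the side of `E.fst` after the removal of the edge `E`. -/
def ContractedEdge.side (E : C.ContractedEdge) : Set C.V :=
  {v | (C.graph.deleteEdges {s(E.fst, E.snd)}).Reachable E.fst v}

/-- The same edge with the opposite orientation. -/
def ContractedEdge.symm (E : C.ContractedEdge) : C.ContractedEdge where
  fst := E.snd
  snd := E.fst
  adj := E.adj.symm
  dir_eq_zero := by
    funext j
    have h1 := C.pos_sub _ _ E.adj j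
    have h2 := C.pos_sub _ _ E.adj.symm j
    have h3 : (0 : ℝ) < C.len s(E.snd, E.fst) := C.len_pos _ E.adj.symm
    rw [E.dir_eq_zero] at h1
    simp only [Pi.zero_apply, Int.cast_zero, mul_zero] at h1
    have h4 : C.len s(E.snd, E.fst) * (C.dir E.snd E.fst j : ℝ) = 0 := by linarith
    rcases mul_eq_zero.mp h4 with h | h
    · exact absurd h h3.ne'
    · exact_mod_cast h

theorem ContractedEdge.fst_mem (E : C.ContractedEdge) : E.fst ∈ E.side :=
  SimpleGraph.Reachable.refl _

theorem ContractedEdge.snd_notMem (E : C.ContractedEdge) : E.snd ∉ E.side := by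
  have h := SimpleGraph.isAcyclic_iff_forall_adj_isBridge.mp C.isTree.isAcyclic E.adj
  exact (SimpleGraph.isBridge_iff.mp h)

theorem ContractedEdge.eq_of_adj (E : C.ContractedEdge) {v w : C.V} (hv : v ∈ E.side)
    (hw : w ∉ E.side) (h : C.graph.Adj v w) : v = E.fst ∧ w = E.snd := by
  by_cases he : s(v, w) = s(E.fst, E.snd)
  · rcases Sym2.eq_iff.mp he with h1 | h1
    · exact h1
    · exact absurd (h1.2 ▸ E.fst_mem) hw
  · exfalso
    apply hw
    refine SimpleGraph.Reachable.trans (show _ from hv) (SimpleGraph.Adj.reachable ?_)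
    rw [SimpleGraph.deleteEdges_adj]
    exact ⟨h, he⟩

theorem ContractedEdge.isTree_induce (E : C.ContractedEdge) :
    (C.graph.induce E.side).IsTree := by
  refine ⟨?_, C.isTree.isAcyclic.induce _⟩
  rw [SimpleGraph.connected_iff_exists_forall_reachable]
  refine ⟨⟨E.fst, E.fst_mem⟩, ?_⟩
  rintro ⟨w, hw⟩
  have key : ∀ (a b : C.V) (p : (C.graph.deleteEdges {s(E.fst, E.snd)}).Walk a b)
      (ha : a ∈ E.side) (hb : b ∈ E.side),
      (C.graph.induce E.side).Reachable ⟨a, ha⟩ ⟨b, hb⟩ := by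
    intro a b p
    induction p with
    | nil => intro _ _; exact SimpleGraph.Reachable.refl _
    | @cons a c b hac _ ih =>
      intro ha hb
      have hc : c ∈ E.side := SimpleGraph.Reachable.trans (show _ from ha) hac.reachable
      refine SimpleGraph.Reachable.trans (SimpleGraph.Adj.reachable ?_) (ih hc hb)
      exact (SimpleGraph.deleteEdges_adj.mp hac).1
  obtain ⟨p⟩ := (show (C.graph.deleteEdges {s(E.fst, E.snd)}).Reachable E.fst w from hw)
  exact key _ _ p E.fst_mem hw

open Classical in
/-- The markings on the component of `E.fst`: the markings of `C` on this side, and one more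
marking `none` for the edge `E` at which `C` is split. -/
abbrev ContractedEdge.Marking (E : C.ContractedEdge) : Type := Option {i : I // C.mark i ∈ E.side}

open Classical in
/-- The component on the side of `E.fst` of the curve `C` split at the contracted bounded edge `E`:
the edge `E` is made into a contracted unbounded edge, which is a new marking. -/
def ContractedEdge.component (E : C.ContractedEdge) : PlaneTropicalCurve E.Marking where
  V := E.side
  U := {u : C.U // C.endAt u ∈ E.side}
  graph := C.graph.induce E.side
  isTree := E.isTree_induce
  len := fun e => C.len (e.map Subtype.val)
  len_pos := by
    intro e
    induction e with
    | h v w => exact fun h => C.len_pos s(v.1, w.1) h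
  mark := fun o => o.elim ⟨E.fst, E.fst_mem⟩ (fun i => ⟨C.mark i.1, i.2⟩)
  endAt := fun u => ⟨C.endAt u.1, u.2⟩
  endDir := fun u => C.endDir u.1
  pos := fun v => C.pos v.1
  dir := fun v w => C.dir v.1 w.1
  pos_sub := fun v w h j => C.pos_sub v.1 w.1 h j
  balanced := by
    rintro ⟨v, hv⟩
    have h := C.balanced v
    rw [← Fintype.sum_subtype_add_sum_subtype (fun w => w ∈ E.side),
      ← Fintype.sum_subtype_add_sum_subtype (fun u => C.endAt u ∈ E.side)] at h
    have h1 : (∑ w : {w // w ∉ E.side}, if C.graph.Adj v w.1 then C.dir v w.1 else 0) = 0 := by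
      refine Finset.sum_eq_zero fun w _ => ?_
      split_ifs with hvw
      · obtain ⟨rfl, h2⟩ := E.eq_of_adj hv w.2 hvw
        rw [h2, E.dir_eq_zero]
      · rfl
    have h2 : (∑ u : {u // C.endAt u ∉ E.side}, if C.endAt u.1 = v then C.endDir u.1 else 0) = 0 := by
      refine Finset.sum_eq_zero fun u _ => ?_
      rw [if_neg]
      rintro rfl
      exact u.2 hv
    rw [h1, h2, add_zero, add_zero] at h
    simpa [Subtype.ext_iff] using h
  three_le_valence := by
    rintro ⟨v, hv⟩
    have h := C.three_le_valence v
    rw [← Fintype.sum_subtype_add_sum_subtype (fun w => w ∈ E.side),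
      ← Fintype.sum_subtype_add_sum_subtype (fun u => C.endAt u ∈ E.side),
      ← Fintype.sum_subtype_add_sum_subtype (fun i => C.mark i ∈ E.side)] at h
    have h1 : (∑ w : {w // w ∉ E.side}, if C.graph.Adj v w.1 then 1 else 0)
        ≤ if E.fst = v then 1 else 0 := by
      by_cases hE : E.fst = v
      · rw [if_pos hE]
        have : ∀ w : {w // w ∉ E.side}, (if C.graph.Adj v w.1 then 1 else 0)
            ≤ if w = ⟨E.snd, E.snd_notMem⟩ then 1 else 0 := by
          intro w
          by_cases hvw : C.graph.Adj v w.1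
          · have := (E.eq_of_adj hv w.2 hvw).2
            rw [if_pos hvw, if_pos (Subtype.ext this)]
          · rw [if_neg hvw]; exact Nat.zero_le _
        refine (Finset.sum_le_sum fun w _ => this w).trans ?_
        simp
      · rw [if_neg hE]
        refine (Finset.sum_eq_zero fun w _ => ?_).le
        rw [if_neg]
        intro hvw
        exact hE (E.eq_of_adj hv w.2 hvw).1.symm
    have h2 : (∑ u : {u // C.endAt u ∉ E.side}, if C.endAt u.1 = v then 1 else 0) = 0 := by
      refine Finset.sum_eq_zero fun u _ => ?_
      rw [if_neg]
      rintro rfl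
      exact u.2 hv
    have h3 : (∑ i : {i // C.mark i ∉ E.side}, if C.mark i.1 = v then 1 else 0) = 0 := by
      refine Finset.sum_eq_zero fun i _ => ?_
      rw [if_neg]
      rintro rfl
      exact i.2 hv
    rw [h2, h3, add_zero, add_zero] at h
    simp only [Fintype.sum_option, Option.elim, Subtype.mk.injEq, SimpleGraph.comap_adj,
      Function.Embedding.subtype_apply]
    refine h.trans ?_
    generalize (∑ w : {w // w ∉ E.side}, if C.graph.Adj v w.1 then 1 else 0) = y at h1
    generalize hx : (if E.fst = v then 1 else 0) = x at h1 ⊢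
    have e1 : (∑ w : {w // w ∈ E.side}, if C.graph.Adj v w.1 then 1 else 0)
      = ∑ w : E.side, if C.graph.Adj v w.1 then 1 else 0 := rfl
    omega

variable (C)

/-! ### The forgetful map to the moduli space of abstract four-marked curves -/

/-- The removal of the edge `e` separates the markings `i`, `j` from the markings `k`, `m`. -/
def Separates (e : Sym2 C.V) (i j k m : I) : Prop :=
  (C.graph.deleteEdges {e}).Reachable (C.mark i) (C.mark j) ∧
  (C.graph.deleteEdges {e}).Reachable (C.mark k) (C.mark m) ∧
  ¬ (C.graph.deleteEdges {e}).Reachable (C.mark i) (C.mark k)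

open Classical in
/-- The total length of the bounded edges that separate `i`, `j` from `k`, `m`: the length of the
path which the subtree spanned by the unbounded edges `i`, `j`, `k`, `m` has between `{i, j}` and
`{k, m}`. -/
def separatingLength (i j k m : I) : ℝ :=
  ∑ e : C.graph.edgeSet, if C.Separates e i j k m then C.len e else 0

end PlaneTropicalCurve

/-- The moduli space of abstract tropical curves with four markings `x₁, x₂, x₃, x₄`: in types
(A), (B), (C) there is one bounded edge, of length `t > 0`, which separates `x₁, x₂` from `x₃, x₄`,
respectively `x₁, x₃` from `x₂, x₄`, respectively `x₁, x₄` from `x₂, x₃`; in type (D) there is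
a single vertex of valence four. -/
inductive M4 : Type
  | A (t : ℝ) (ht : 0 < t)
  | B (t : ℝ) (ht : 0 < t)
  | C (t : ℝ) (ht : 0 < t)
  | D

open Classical in
/-- The forgetful map: keep the subtree spanned by the four markings `x 0, …, x 3`, straighten its
two-valent vertices, and forget the map to the plane. -/
def PlaneTropicalCurve.forget {I : Type} [Fintype I] (C : PlaneTropicalCurve I) (x : Fin 4 → I) :
    M4 :=
  if hA : 0 < C.separatingLength (x 0) (x 1) (x 2) (x 3) then M4.A _ hA
  else if hB : 0 < C.separatingLength (x 0) (x 2) (x 1) (x 3) then M4.B _ hB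
  else if hC : 0 < C.separatingLength (x 0) (x 3) (x 1) (x 2) then M4.C _ hC
  else M4.D

/-! ### Tropical curves of degree `l` in the plane, as corner loci -/

/-- The exponents of the monomials of degree at most `l`. -/
def exponents (l : ℕ) : Finset (ℕ × ℕ) :=
  (Finset.range (l + 1) ×ˢ Finset.range (l + 1)).filter fun m => m.1 + m.2 ≤ l

/-- The value at `q` of the tropical monomial with exponent `m` and coefficient `a m`. -/
def monomialValue (a : ℕ × ℕ → ℝ) (q : Fin 2 → ℝ) (m : ℕ × ℕ) : ℝ :=
  a m + m.1 * q 0 + m.2 * q 1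

open Classical in
/-- The exponents at which the tropical polynomial `max_m (a m + m.1 * q 0 + m.2 * q 1)`, over all
monomials of degree at most `l`, attains its maximum. -/
def maximizers (l : ℕ) (a : ℕ × ℕ → ℝ) (q : Fin 2 → ℝ) : Finset (ℕ × ℕ) :=
  (exponents l).filter fun m => ∀ m' ∈ exponents l, monomialValue a q m' ≤ monomialValue a q m

/-- The tropical plane curve of degree `l` given by the coefficients `a`: the points at which the
maximum is attained at least twice. -/
def tropicalPlaneCurve (l : ℕ) (a : ℕ × ℕ → ℝ) : Set (Fin 2 → ℝ) :=
  {q | 2 ≤ (maximizers l a q).card}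

/-- `m - m'` as an integral vector. -/
def exponentDiff (m m' : ℕ × ℕ) : Fin 2 → ℤ := ![(m.1 : ℤ) - m'.1, (m.2 : ℤ) - m'.2]

/-- The points in the relative interior of an edge of the curve: the monomials which attain the
maximum have exponents on one line. -/
def IsEdgePoint (l : ℕ) (a : ℕ × ℕ → ℝ) (q : Fin 2 → ℝ) : Prop :=
  q ∈ tropicalPlaneCurve l a ∧
    ∀ m ∈ maximizers l a q, ∀ m' ∈ maximizers l a q, ∀ m'' ∈ maximizers l a q,
      exponentDiff m' m 0 * exponentDiff m'' m 1 = exponentDiff m' m 1 * exponentDiff m'' m 0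

theorem maximizers_nonempty (l : ℕ) (a : ℕ × ℕ → ℝ) (q : Fin 2 → ℝ) :
    (maximizers l a q).Nonempty := by
  have h : (exponents l).Nonempty := ⟨(0, 0), by simp [exponents]⟩
  obtain ⟨m, hm, hmax⟩ := Finset.exists_max_image (exponents l) (monomialValue a q) h
  exact ⟨m, by simp only [maximizers, Finset.mem_filter]; exact ⟨hm, hmax⟩⟩

theorem exists_longest (l : ℕ) (a : ℕ × ℕ → ℝ) (q : Fin 2 → ℝ) :
    ∃ ν : Fin 2 → ℤ, (∃ m ∈ maximizers l a q, ∃ m' ∈ maximizers l a q, ν = exponentDiff m m') ∧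
      ∀ m ∈ maximizers l a q, ∀ m' ∈ maximizers l a q,
        exponentDiff m m' 0 ^ 2 + exponentDiff m m' 1 ^ 2 ≤ ν 0 ^ 2 + ν 1 ^ 2 := by
  have h := maximizers_nonempty l a q
  obtain ⟨p, hp, hmax⟩ := Finset.exists_max_image (maximizers l a q ×ˢ maximizers l a q)
    (fun p => exponentDiff p.1 p.2 0 ^ 2 + exponentDiff p.1 p.2 1 ^ 2) (h.product h)
  rw [Finset.mem_product] at hp
  exact ⟨_, ⟨_, hp.1, _, hp.2, rfl⟩, fun m hm m' hm' =>
    hmax (m, m') (Finset.mem_product.mpr ⟨hm, hm'⟩)⟩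

/-- At an edge point `q`: the normal vector, unique up to sign, of the edge through `q`, of lattice
length the weight of the edge.  It is the longest difference of two exponents which attain the
maximum, that is, the edge of the Newton subdivision dual to the edge through `q`. -/
def edgeNormal (l : ℕ) (a : ℕ × ℕ → ℝ) (q : Fin 2 → ℝ) : Fin 2 → ℤ :=
  (exists_longest l a q).choose

/-! ### The map `π̃` and its multiplicities -/

/-- The markings `x₁, …, x₄`. -/
abbrev firstFour {n : ℕ} (hn : 4 ≤ n) : Fin 4 → Fin n := Fin.castLE hn

/-- The markings `x₃, …, x_n` (`x_{i+1}` being the marking with the index `i : Fin n`). -/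
abbrev PointMarking (n : ℕ) : Type := {i : Fin n // 2 ≤ (i : ℕ)}

/-- The domain of `π̃`: the rational plane tropical curves of degree `d` with `n` markings, the first
two of which are mapped to the tropical curve of degree `l` with coefficients `a`. -/
structure Domain (d n : ℕ) (hn : 4 ≤ n) (l : ℕ) (a : ℕ × ℕ → ℝ) extends
    PlaneTropicalCurve (Fin n) where
  degree_eq : toPlaneTropicalCurve.degree = standardDegree d
  ev_first : toPlaneTropicalCurve.ev (firstFour hn 0) ∈ tropicalPlaneCurve l a
  ev_second : toPlaneTropicalCurve.ev (firstFour hn 1) ∈ tropicalPlaneCurve l a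

namespace Domain

variable {d n l : ℕ} {hn : 4 ≤ n} {a : ℕ × ℕ → ℝ} (C : Domain d n hn l a)

/-- The map `π̃ = ev₃ × ⋯ × ev_n × δ`. -/
def piTilde : (PointMarking n → Fin 2 → ℝ) × M4 :=
  (fun i => C.ev i.1, C.forget (firstFour hn))

/-- `C` is a general point of the domain, i.e. it lies in a cell of codimension zero: its
combinatorial type has codimension zero, and `x₁`, `x₂` are mapped to the relative interiors of edges
of the curve of degree `l`. -/
def IsGeneral : Prop :=
  C.IsTrivalent ∧ IsEdgePoint l a (C.ev (firstFour hn 0)) ∧ IsEdgePoint l a (C.ev (firstFour hn 1))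

/-- The coordinates of the cell of the moduli space of plane tropical curves given by the
combinatorial type of `C`: the position of the root vertex, for which the vertex at `x₁` is taken, and
the lengths of the bounded edges. -/
abbrev Coordinate : Type := Fin 2 ⊕ C.graph.edgeSet

/-- The unique path in the tree from the root vertex to `v`. -/
def pathTo (v : C.V) : C.graph.Walk (C.mark (firstFour hn 0)) v :=
  (C.isTree.existsUnique_path (C.mark (firstFour hn 0)) v).choose

open Classical in
/-- The coefficient of the coordinate `c` in the `j`-th component of the position of the vertex `v`,
which is the position of the root plus the sum, over the edges on the path from the root to `v`, of
the length times the direction vector. -/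
def posCoeff (v : C.V) (j : Fin 2) : C.Coordinate → ℝ
  | Sum.inl k => if k = j then 1 else 0
  | Sum.inr e =>
    (((C.pathTo v).darts.filter fun D => D.edge = e.1).map fun D => (C.dir D.fst D.snd j : ℝ)).sum

open Classical in
/-- The coefficient of the coordinate `c` in the length of the bounded edge of the four-marked curve
obtained by forgetting. -/
def forgetCoeff : C.Coordinate → ℝ
  | Sum.inl _ => 0
  | Sum.inr e =>
    if C.Separates e (firstFour hn 0) (firstFour hn 1) (firstFour hn 2) (firstFour hn 3) ∨
      C.Separates e (firstFour hn 0) (firstFour hn 2) (firstFour hn 1) (firstFour hn 3) ∨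
      C.Separates e (firstFour hn 0) (firstFour hn 3) (firstFour hn 1) (firstFour hn 2) then 1
    else 0

/-- The rows of the matrix of `π̃`: one for each of `x₁`, `x₂`, two for each of `x₃, …, x_n`, and one
for the coordinate of the moduli space of four-marked curves. -/
abbrev Row (n : ℕ) : Type := Fin 2 ⊕ (PointMarking n × Fin 2) ⊕ Unit

/-- The matrix of the linear map underlying `π̃` on the cell of `C`, together with the two conditions
that `x₁` and `x₂` stay on the edges of the curve of degree `l` on which they are: the row of `x₁`
(and likewise of `x₂`) is the evaluation at `x₁` in the direction normal to the edge through its image,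
scaled by the weight of this edge. -/
def matrix : Matrix (Row n) C.Coordinate ℝ
  | Sum.inl i, c => ∑ j : Fin 2,
      (edgeNormal l a (C.ev (firstFour hn (Fin.castLE (by omega) i))) j : ℝ)
        * C.posCoeff (C.mark (firstFour hn (Fin.castLE (by omega) i))) j c
  | Sum.inr (Sum.inl (i, j)), c => C.posCoeff (C.mark i.1) j c
  | Sum.inr (Sum.inr _), c => C.forgetCoeff c

open Classical in
/-- The multiplicity of `π̃` at a general point `C`: the absolute value of the determinant.  (The
matrix is a square matrix if `n = 3 * d` and `C` is trivalent; the absolute value does not depend on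
how the rows and columns are ordered.) -/
def mult : ℝ :=
  if h : Fintype.card (Row n) = Fintype.card C.Coordinate then
    |(C.matrix.submatrix id (Fintype.equivOfCardEq h)).det|
  else 0

/-- The markings `x₁` and `x₂` are adjacent to the same vertex. -/
def FirstTwoAdjacent : Prop := C.mark (firstFour hn 0) = C.mark (firstFour hn 1)

open Classical in
/-- `C` decomposes uniquely into `C₁` and `C₂`: it has exactly one contracted bounded edge, and the
two components of `C` split at this edge are curves `C₁`, `C₂` of degrees `d₁, d₂ > 0` with
`d₁ + d₂ = d`, such that `x₁, x₂` are on `C₁`, such that `x₃, x₄` are on `C₂`, and such that exactly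
`3 * d₁ - 1` of the markings `x₅, …, x_n` are on `C₁`. -/
def DecomposesUniquely : Prop :=
  ∃ E : C.ContractedEdge,
    (∀ E' : C.ContractedEdge, s(E'.fst, E'.snd) = s(E.fst, E.snd)) ∧
    ∃ d₁ d₂ : ℕ, 0 < d₁ ∧ 0 < d₂ ∧ d₁ + d₂ = d ∧
      E.component.degree = standardDegree d₁ ∧
      E.symm.component.degree = standardDegree d₂ ∧
      C.mark (firstFour hn 0) ∈ E.side ∧ C.mark (firstFour hn 1) ∈ E.side ∧
      C.mark (firstFour hn 2) ∈ E.symm.side ∧ C.mark (firstFour hn 3) ∈ E.symm.side ∧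
      {i : Fin n | 4 ≤ (i : ℕ) ∧ C.mark i ∈ E.side}.ncard = 3 * d₁ - 1

end Domain

end

end PlaneTropical

/-! A nonzero multiplicity says that the linear map of the cell has no kernel. A displacement `D` of
the vertices, with a compatible change `ℓ` of the lengths, must vanish if it fixes `x₃, …, x_n`,
keeps `x₁`, `x₂` tangent to their edges of the degree `l` curve, and does not change the total
length separating `x₁`, `x₂` from `x₃`, `x₄` (`Domain.eq_zero_of_sep`).

If `C` has a contracted bounded edge, its length moves no vertex. Hence such an edge must separate
`x₁`, `x₂` from `x₃`, `x₄`, and there is only one. On each side, too few markings would leave a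
deformation (`ContractedEdge.card_sideFinset_le`). The resulting bounds on the two sides add up to
the total number `3 * d` of markings, so both are equalities, and this gives (b) unless (a) holds.

Suppose now that counterexamples exist for arbitrarily large `t`. By the first case they have no
contracted bounded edge. There are finitely many combinatorial types, so infinitely many of them
share one type. Two curves of this type over the same points differ by `(t' - t) • D` for a fixed
`D`. As `t'` is unbounded, `D` shortens no edge, and it moves `x₁`, `x₂` by nonnegative multiples of
the directions `(-1,0)`, `(0,-1)`, `(1,1)`. Without contracted edges, all deformations are multiples
of `D`.

The core is `exists_leaf`: for such a `D` only one vertex moves, and it has a single bounded edge.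
By symmetry some vertex may be assumed to move to the left. A component `S` of the set of vertices
that move furthest left has only flags pointing right on its boundary, and balancing forces ends of
direction `(-1,0)` at `S`. Three ends at `S` would give a second independent deformation, and the
cases of one or two ends are settled by balancing and counting.

Consequently the only separating edge whose length changes cuts off this single moving vertex.
Either `x₁`, `x₂` are both there, which is (a), or the fixed marking `x₃` is there, which is absurd.
-/

namespace PlaneTropical

/-! ### Balancing and counting of flags for a set of vertices -/

namespace PlaneTropicalCurve

variable {I : Type} [Fintype I] (C : PlaneTropicalCurve I)

theorem dir_swap {v w : C.V} (h : C.graph.Adj v w) : C.dir w v = -C.dir v w := by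
  funext j
  have h1 := C.pos_sub _ _ h j
  have h2 := C.pos_sub _ _ h.symm j
  have h3 : (0 : ℝ) < C.len s(v, w) := C.len_pos _ h
  rw [Sym2.eq_swap] at h2
  have h4 : C.len s(v, w) * ((C.dir v w j : ℝ) + C.dir w v j) = 0 := by linarith
  rcases mul_eq_zero.mp h4 with h | h
  · exact absurd h h3.ne'
  · have : C.dir v w j + C.dir w v j = 0 := by exact_mod_cast h
    simp only [Pi.neg_apply]
    omega

open Classical in
/-- The bounded flags that leave a set of vertices. -/
noncomputable def boundary (S : Finset C.V) : Finset (C.V × C.V) :=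
  (S ×ˢ Sᶜ).filter fun p => C.graph.Adj p.1 p.2

open Classical in
/-- The unmarked unbounded edges at a set of vertices. -/
noncomputable def endsIn (S : Finset C.V) : Finset C.U := Finset.univ.filter fun u => C.endAt u ∈ S

open Classical in
/-- The markings at a set of vertices. -/
noncomputable def marksIn (S : Finset C.V) : Finset I := Finset.univ.filter fun i => C.mark i ∈ S

theorem mem_boundary {S : Finset C.V} {p : C.V × C.V} :
    p ∈ C.boundary S ↔ p.1 ∈ S ∧ p.2 ∉ S ∧ C.graph.Adj p.1 p.2 := by
  simp [boundary, and_assoc]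

theorem mem_endsIn {S : Finset C.V} {u : C.U} : u ∈ C.endsIn S ↔ C.endAt u ∈ S := by
  simp [endsIn]

theorem mem_marksIn {S : Finset C.V} {i : I} : i ∈ C.marksIn S ↔ C.mark i ∈ S := by
  simp [marksIn]

open Classical in
theorem sum_boundary {M : Type} [AddCommMonoid M] (S : Finset C.V) (f : C.V → C.V → M) :
    ∑ p ∈ C.boundary S, f p.1 p.2 = ∑ v ∈ S, ∑ w ∈ Sᶜ, if C.graph.Adj v w then f v w else 0 := by
  rw [boundary, Finset.sum_filter, Finset.sum_product]

open Classical in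
theorem sum_ite_eq_sum_fiber {M X : Type} [Fintype X] [AddCommMonoid M] (S : Finset C.V)
    (g : X → C.V) (f : X → M) :
    ∑ v ∈ S, ∑ u, (if g u = v then f u else 0)
      = ∑ u ∈ Finset.univ.filter (fun u => g u ∈ S), f u := by
  rw [Finset.sum_comm, Finset.sum_filter]
  refine Finset.sum_congr rfl fun u _ => ?_
  rw [Finset.sum_ite_eq]

/-- The directions of the flags that leave a set of vertices add up to zero. -/
theorem sum_boundary_add_sum_endsIn (S : Finset C.V) :
    ∑ p ∈ C.boundary S, C.dir p.1 p.2 + ∑ u ∈ C.endsIn S, C.endDir u = 0 := by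
  classical
  have h : ∑ v ∈ S, ((∑ w, if C.graph.Adj v w then C.dir v w else 0)
      + (∑ u, if C.endAt u = v then C.endDir u else 0)) = 0 :=
    Finset.sum_eq_zero fun v _ => by convert C.balanced v
  have hin : ∑ v ∈ S, ∑ w ∈ S, (if C.graph.Adj v w then C.dir v w else 0) = 0 := by
    have h1 : ∑ v ∈ S, ∑ w ∈ S, (if C.graph.Adj v w then C.dir v w else 0)
        = -∑ v ∈ S, ∑ w ∈ S, (if C.graph.Adj v w then C.dir v w else 0) := by
      conv_lhs => rw [Finset.sum_comm]
      rw [← Finset.sum_neg_distrib]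
      refine Finset.sum_congr rfl fun v _ => ?_
      rw [← Finset.sum_neg_distrib]
      refine Finset.sum_congr rfl fun w _ => ?_
      by_cases hvw : C.graph.Adj v w
      · rw [if_pos hvw, if_pos hvw.symm, C.dir_swap hvw]
      · rw [if_neg hvw, if_neg (fun h => hvw h.symm), neg_zero]
    exact self_eq_neg.mp h1
  rw [Finset.sum_add_distrib, sum_ite_eq_sum_fiber] at h
  have h4 : ∑ v ∈ S, ∑ w, (if C.graph.Adj v w then C.dir v w else 0)
      = ∑ v ∈ S, ∑ w ∈ S, (if C.graph.Adj v w then C.dir v w else 0)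
        + ∑ v ∈ S, ∑ w ∈ Sᶜ, (if C.graph.Adj v w then C.dir v w else 0) := by
    rw [← Finset.sum_add_distrib]
    exact Finset.sum_congr rfl fun v _ => (Finset.sum_add_sum_compl S _).symm
  rw [h4, hin, zero_add] at h
  rw [sum_boundary, endsIn]
  exact h

theorem sum_boundary_apply (S : Finset C.V) (j : Fin 2) :
    ∑ p ∈ C.boundary S, C.dir p.1 p.2 j + ∑ u ∈ C.endsIn S, C.endDir u j = 0 := by
  have h := congrFun (C.sum_boundary_add_sum_endsIn S) j
  simpa [Finset.sum_apply] using h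

open Classical in
theorem two_mul_card_edgeSet_induce (S : Finset C.V) :
    ∑ v ∈ S, ∑ w ∈ S, (if C.graph.Adj v w then 1 else 0)
      = 2 * Fintype.card (C.graph.induce (S : Set C.V)).edgeSet := by
  rw [← SimpleGraph.edgeFinset_card, ← SimpleGraph.sum_degrees_eq_twice_card_edges]
  rw [← Finset.sum_coe_sort S]
  refine Finset.sum_congr rfl fun v _ => ?_
  rw [← Finset.sum_coe_sort S, ← SimpleGraph.card_neighborFinset_eq_degree, Finset.sum_boole,
    Nat.cast_id]
  congr 1
  ext w
  simp

open Classical in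
theorem card_edgeSet_induce {S : Finset C.V} (hS : (C.graph.induce (S : Set C.V)).IsTree) :
    Fintype.card (C.graph.induce (S : Set C.V)).edgeSet + 1 = S.card := by
  have h := hS.card_edgeFinset
  rw [SimpleGraph.edgeFinset_card] at h
  rw [h]
  simp

/-- The valences on `S` add up to `3 * S.card`. Each of the `S.card - 1` edges of the subtree is
counted twice, all other flags once. -/
theorem card_add_two {S : Finset C.V} (hC : C.IsTrivalent)
    (hS : (C.graph.induce (S : Set C.V)).IsTree) :
    S.card + 2 = (C.boundary S).card + (C.endsIn S).card + (C.marksIn S).card := by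
  classical
  have h : ∑ v ∈ S, C.valence v = 3 * S.card := by
    rw [Finset.sum_congr rfl fun v _ => hC v]
    simp [mul_comm]
  have h1 := C.two_mul_card_edgeSet_induce S
  have h2 := C.card_edgeSet_induce hS
  have h3 := C.sum_boundary S fun _ _ => (1 : ℕ)
  simp only [valence] at h
  rw [Finset.sum_add_distrib, Finset.sum_add_distrib, sum_ite_eq_sum_fiber,
    sum_ite_eq_sum_fiber] at h
  have h4 : ∑ v ∈ S, ∑ w, (if C.graph.Adj v w then 1 else 0)
      = ∑ v ∈ S, ∑ w ∈ S, (if C.graph.Adj v w then 1 else 0)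
        + ∑ v ∈ S, ∑ w ∈ Sᶜ, (if C.graph.Adj v w then 1 else 0) := by
    rw [← Finset.sum_add_distrib]
    exact Finset.sum_congr rfl fun v _ => (Finset.sum_add_sum_compl S _).symm
  rw [h4, ← h3, h1] at h
  simp only [← Finset.card_eq_sum_ones] at h
  rw [endsIn, marksIn]
  omega

theorem not_reachable_deleteEdges {v w : C.V} (h : C.graph.Adj v w) :
    ¬ (C.graph.deleteEdges {s(v, w)}).Reachable v w :=
  SimpleGraph.isBridge_iff.mp (SimpleGraph.isAcyclic_iff_forall_adj_isBridge.mp C.isTree.isAcyclic h)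

/-- The only bounded edge that leaves one side of an edge is this edge. -/
theorem eq_of_adj_of_reachable {v w x y : C.V} (hvw : C.graph.Adj v w) (hxy : C.graph.Adj x y)
    (hx : (C.graph.deleteEdges {s(v, w)}).Reachable v x)
    (hy : ¬ (C.graph.deleteEdges {s(v, w)}).Reachable v y) : x = v ∧ y = w := by
  by_cases he : s(x, y) = s(v, w)
  · rcases Sym2.eq_iff.mp he with h1 | h1
    · exact h1
    · exact absurd (h1.1 ▸ hx) (C.not_reachable_deleteEdges hvw)
  · refine absurd (hx.trans (SimpleGraph.Adj.reachable ?_)) hy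
    rw [SimpleGraph.deleteEdges_adj]
    exact ⟨hxy, he⟩

/-- If a coordinate vanishes on all flags that leave a set of vertices, then it vanishes on all
bounded edges in this set. -/
theorem dir_apply_eq_zero {S : Finset C.V} {j : Fin 2}
    (hb : ∀ p ∈ C.boundary S, C.dir p.1 p.2 j = 0) (he : ∀ u ∈ C.endsIn S, C.endDir u j = 0)
    {v w : C.V} (hv : v ∈ S) (hw : w ∈ S) (hvw : C.graph.Adj v w) : C.dir v w j = 0 := by
  classical
  -- Balancing is applied to the part of `S` on one side of the edge from `v` to `w`. Among its
  -- flags only this edge can have a nonzero `j`-th coordinate.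
  set A := S.filter fun x => (C.graph.deleteEdges {s(v, w)}).Reachable v x with hA
  have h := C.sum_boundary_apply A j
  have h1 : ∑ u ∈ C.endsIn A, C.endDir u j = 0 := by
    refine Finset.sum_eq_zero fun u hu => he u ?_
    rw [mem_endsIn] at hu ⊢
    exact (Finset.mem_filter.mp hu).1
  have h2 : ∑ p ∈ C.boundary A, C.dir p.1 p.2 j = C.dir v w j := by
    refine Finset.sum_eq_single (v, w) ?_ ?_
    · rintro ⟨x, y⟩ hp hne
      rw [mem_boundary] at hp
      obtain ⟨hx, hy, hxy⟩ := hp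
      dsimp only at hx hy hxy
      rw [hA, Finset.mem_filter] at hx hy
      by_cases hyS : y ∈ S
      · obtain ⟨rfl, rfl⟩ := C.eq_of_adj_of_reachable hvw hxy hx.2 fun h => hy ⟨hyS, h⟩
        exact absurd rfl hne
      · exact hb (x, y) (C.mem_boundary.mpr ⟨hx.1, hyS, hxy⟩)
    · intro hn
      refine absurd (C.mem_boundary.mpr ⟨?_, ?_, hvw⟩) hn
      · exact Finset.mem_filter.mpr ⟨hv, SimpleGraph.Reachable.refl _⟩
      · exact fun h => C.not_reachable_deleteEdges hvw (Finset.mem_filter.mp h).2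
  omega

/-! ### Infinitesimal deformations -/

/-- The displacements of the vertices of an edge differ by a multiple of its direction if and only if
this determinant vanishes (for an edge which is not contracted). -/
def bend (v w : C.V) : (C.V → Fin 2 → ℝ) →ₗ[ℝ] ℝ where
  toFun D := C.dir v w 0 * (D w 1 - D v 1) - C.dir v w 1 * (D w 0 - D v 0)
  map_add' D D' := by simp only [Pi.add_apply]; ring
  map_smul' c D := by simp only [Pi.smul_apply, smul_eq_mul, RingHom.id_apply]; ring

theorem bend_apply (v w : C.V) (D : C.V → Fin 2 → ℝ) : C.bend v w D
    = C.dir v w 0 * (D w 1 - D v 1) - C.dir v w 1 * (D w 0 - D v 0) := rfl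

theorem bend_swap {v w : C.V} (h : C.graph.Adj v w) (D : C.V → Fin 2 → ℝ) :
    C.bend w v D = C.bend v w D := by
  rw [bend_apply, bend_apply, C.dir_swap h]
  simp only [Pi.neg_apply, Int.cast_neg]
  ring

variable {C} in
theorem bend_eq_zero_of_eq {v w : C.V} {D : C.V → Fin 2 → ℝ} (h : D v = D w) :
    C.bend v w D = 0 := by
  rw [bend_apply, h]; ring

/-- A component of the displacement of a vertex. -/
def coord {V : Type} (v : V) (j : Fin 2) : (V → Fin 2 → ℝ) →ₗ[ℝ] ℝ where
  toFun D := D v j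
  map_add' _ _ := rfl
  map_smul' _ _ := rfl

@[simp] theorem coord_apply {V : Type} (v : V) (j : Fin 2) (D : V → Fin 2 → ℝ) :
    coord v j D = D v j := rfl

/-- Fewer linear conditions than unknowns have a nonzero solution with support in `A`. -/
theorem exists_ne_zero_of_card_lt {V J : Type} [Fintype J] (A : Finset V)
    (g : J → (V → Fin 2 → ℝ) →ₗ[ℝ] ℝ) (h : Fintype.card J < 2 * A.card) :
    ∃ D : V → Fin 2 → ℝ, D ≠ 0 ∧ (∀ v, v ∉ A → D v = 0) ∧ ∀ j, g j D = 0 := by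
  classical
  let ext : (A → Fin 2 → ℝ) →ₗ[ℝ] (V → Fin 2 → ℝ) :=
    { toFun := fun x v => if h : v ∈ A then x ⟨v, h⟩ else 0
      map_add' := fun x y => by funext v; by_cases h : v ∈ A <;> simp [h]
      map_smul' := fun c x => by funext v; by_cases h : v ∈ A <;> simp [h] }
  have hext : ∀ x (v : A), ext x v = x v := fun x v => by simp [ext]
  have hk := LinearMap.ker_ne_bot_of_finrank_lt (f := (LinearMap.pi g).comp ext) (by
    rw [Module.finrank_pi, Module.finrank_pi_fintype]
    simpa [mul_comm] using h)
  obtain ⟨x, hx, hx0⟩ := Submodule.exists_mem_ne_zero_of_ne_bot hk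
  refine ⟨ext x, ?_, ?_, ?_⟩
  · intro h0
    apply hx0
    funext v
    rw [← hext x v, h0]
    rfl
  · intro v hv
    simp [ext, hv]
  · intro j
    exact congrFun (LinearMap.mem_ker.mp hx) j

/-- The condition `bend = 0` for a bounded edge. -/
noncomputable def edgeBend (S : Finset C.V) (e : (C.graph.induce (S : Set C.V)).edgeSet) :
    (C.V → Fin 2 → ℝ) →ₗ[ℝ] ℝ := C.bend (Quot.out e.1).1.1 (Quot.out e.1).2.1

theorem bend_eq_zero_of_edgeBend {S : Finset C.V} {D : C.V → Fin 2 → ℝ}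
    (h : ∀ e, C.edgeBend S e D = 0) {v w : C.V} (hv : v ∈ S) (hw : w ∈ S)
    (hvw : C.graph.Adj v w) : C.bend v w D = 0 := by
  have h1 := h ⟨s(⟨v, hv⟩, ⟨w, hw⟩), hvw⟩
  rw [edgeBend] at h1
  generalize hq : Quot.out (s((⟨v, hv⟩ : (S : Set C.V)), ⟨w, hw⟩)) = q at h1
  have h2 : s(q.1, q.2) = s(⟨v, hv⟩, ⟨w, hw⟩) := by
    rw [← hq]; exact Quot.out_eq _
  rcases Sym2.eq_iff.mp h2 with ⟨h3, h4⟩ | ⟨h3, h4⟩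
  · simpa [h3, h4] using h1
  · rw [← C.bend_swap hvw]
    simpa [h3, h4] using h1

/-- The infinitesimal deformations of a curve for which the markings in `P` are fixed and the
displacements of the other markings are orthogonal to the given normal vectors. -/
structure IsDeformation (P : I → Prop) (ν : I → Fin 2 → ℝ) (D : C.V → Fin 2 → ℝ) : Prop where
  bend_eq_zero : ∀ v w, C.graph.Adj v w → C.bend v w D = 0
  fixed : ∀ i, P i → D (C.mark i) = 0
  normal : ∀ i, ¬ P i → ν i 0 * D (C.mark i) 0 + ν i 1 * D (C.mark i) 1 = 0

/-- The condition at a marking with a given normal vector. -/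
def normalCond (ν : I → Fin 2 → ℝ) (i : I) : (C.V → Fin 2 → ℝ) →ₗ[ℝ] ℝ :=
  ν i 0 • coord (C.mark i) 0 + ν i 1 • coord (C.mark i) 1

/-- A set of vertices with sufficiently many unmarked unbounded edges and without fixed markings
can be deformed, with all other vertices being fixed. -/
theorem exists_isDeformation {P : I → Prop} {ν : I → Fin 2 → ℝ} (hC : C.IsTrivalent)
    {S : Finset C.V} (hS : (C.graph.induce (S : Set C.V)).IsTree)
    (hP : ∀ i, P i → C.mark i ∉ S) {k : ℕ} (hk : k + 2 ≤ (C.endsIn S).card)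
    (g : Fin k → (C.V → Fin 2 → ℝ) →ₗ[ℝ] ℝ) :
    ∃ D, D ≠ 0 ∧ C.IsDeformation P ν D ∧ (∀ v, v ∉ S → D v = 0) ∧ ∀ j, g j D = 0 := by
  classical
  have h1 := C.card_add_two hC hS
  have h2 := C.card_edgeSet_induce hS
  -- There are `2 * S.card` unknowns. The conditions come from the `S.card - 1` inner edges, the
  -- boundary flags, the markings and `g`. By `card_add_two` their number is `2 * S.card + 1 + k`
  -- minus the number of ends, which is less than `2 * S.card` by `hk`.
  obtain ⟨D, hD0, hDS, hD⟩ := exists_ne_zero_of_card_lt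
    (J := (C.graph.induce (S : Set C.V)).edgeSet ⊕ C.boundary S ⊕ C.marksIn S ⊕ Fin k) S
    (Sum.elim (C.edgeBend S) (Sum.elim (fun p => C.bend p.1.1 p.1.2)
      (Sum.elim (fun i => C.normalCond ν i) g))) (by
    simp only [Fintype.card_sum, Fintype.card_coe, Fintype.card_fin]
    omega)
  refine ⟨D, hD0, ⟨fun v w hvw => ?_, fun i hi => hDS _ (hP i hi), fun i _ => ?_⟩, hDS,
    fun j => hD (Sum.inr (Sum.inr (Sum.inr j)))⟩
  · by_cases hv : v ∈ S <;> by_cases hw : w ∈ S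
    · exact C.bend_eq_zero_of_edgeBend (fun e => hD (Sum.inl e)) hv hw hvw
    · exact hD (Sum.inr (Sum.inl ⟨(v, w), C.mem_boundary.mpr ⟨hv, hw, hvw⟩⟩))
    · rw [← C.bend_swap hvw]
      exact hD (Sum.inr (Sum.inl ⟨(w, v), C.mem_boundary.mpr ⟨hw, hv, hvw.symm⟩⟩))
    · exact bend_eq_zero_of_eq (by rw [hDS v hv, hDS w hw])
  · by_cases hi : C.mark i ∈ S
    · exact hD (Sum.inr (Sum.inr (Sum.inl ⟨i, C.mem_marksIn.mpr hi⟩)))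
    · rw [hDS _ hi]; simp

end PlaneTropicalCurve

/-! ### Deformations that do not shorten any bounded edge -/

/-- The directions of the unmarked unbounded edges of a plane curve. -/
def IsStandardDir (e : Fin 2 → ℤ) : Prop := e = ![-1, 0] ∨ e = ![0, -1] ∨ e = ![1, 1]

namespace PlaneTropicalCurve

variable {I : Type} [Fintype I] (C : PlaneTropicalCurve I)

theorem eq_of_closed {S A : Finset C.V} (hS : (C.graph.induce (S : Set C.V)).IsTree)
    (hAS : A ⊆ S) (hA : A.Nonempty)
    (hcl : ∀ v ∈ A, ∀ w ∈ S, C.graph.Adj v w → w ∈ A) : A = S := by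
  refine Finset.Subset.antisymm hAS fun w hw => ?_
  by_contra hwA
  obtain ⟨v, hv⟩ := hA
  obtain ⟨p⟩ := hS.connected.preconnected ⟨v, hAS hv⟩ ⟨w, hw⟩
  obtain ⟨d, -, h1, h2⟩ := p.exists_boundary_dart {x | x.1 ∈ A} hv hwA
  exact h2 (hcl _ h1 _ d.snd.2 d.adj)

theorem boundary_nonempty {S : Finset C.V} {v w : C.V} (hv : v ∈ S) (hw : w ∉ S) :
    (C.boundary S).Nonempty := by
  obtain ⟨p⟩ := C.isTree.connected.preconnected v w
  obtain ⟨d, -, h1, h2⟩ := p.exists_boundary_dart (S : Set C.V) hv hw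
  exact ⟨(d.fst, d.snd), C.mem_boundary.mpr ⟨h1, h2, d.adj⟩⟩

/-- A connected component of a level set of a function on the vertices. -/
theorem exists_component (f : C.V → ℝ) (v₀ : C.V) : ∃ S : Finset C.V, v₀ ∈ S ∧
    (∀ v ∈ S, f v = f v₀) ∧ (C.graph.induce (S : Set C.V)).IsTree ∧
    ∀ p ∈ C.boundary S, f p.2 ≠ f v₀ := by
  classical
  -- The tree with only those edges kept whose two ends lie in the level set; `S` is the component
  -- of `v₀` in it.
  let G : SimpleGraph C.V :=
    { Adj := fun v w => C.graph.Adj v w ∧ f v = f v₀ ∧ f w = f v₀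
      symm := ⟨fun v w h => ⟨h.1.symm, h.2.2, h.2.1⟩⟩
      loopless := ⟨fun v h => C.graph.loopless.irrefl v h.1⟩ }
  have hG : ∀ v w, G.Adj v w ↔ C.graph.Adj v w ∧ f v = f v₀ ∧ f w = f v₀ := fun _ _ => Iff.rfl
  have hlevel : ∀ v, G.Reachable v₀ v → f v = f v₀ := by
    intro v hv
    by_contra hne
    obtain ⟨p⟩ := hv
    obtain ⟨d, -, h1, h2⟩ := p.exists_boundary_dart {x | f x = f v₀} rfl hne
    exact h2 d.adj.2.2
  refine ⟨Finset.univ.filter fun v => G.Reachable v₀ v, ?_, ?_, ⟨?_, C.isTree.isAcyclic.induce _⟩,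
    ?_⟩
  · exact Finset.mem_filter.mpr ⟨Finset.mem_univ _, SimpleGraph.Reachable.refl _⟩
  · exact fun v hv => hlevel v (Finset.mem_filter.mp hv).2
  · rw [SimpleGraph.connected_iff_exists_forall_reachable]
    refine ⟨⟨v₀, by simp⟩, ?_⟩
    rintro ⟨w, hw⟩
    by_contra hne
    have hw' : G.Reachable v₀ w := by simpa using hw
    obtain ⟨p⟩ := hw'
    obtain ⟨d, -, ⟨h1, h1'⟩, h2⟩ := p.exists_boundary_dart
      {x | ∃ hx : x ∈ ((Finset.univ.filter fun v => G.Reachable v₀ v : Finset C.V) : Set C.V),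
        (C.graph.induce _).Reachable ⟨v₀, by simp⟩ ⟨x, hx⟩}
      ⟨by simp, SimpleGraph.Reachable.refl _⟩ (fun ⟨hx, h⟩ => hne h)
    have h3 : G.Reachable v₀ d.fst := by simpa using h1
    have h4 : G.Reachable v₀ d.snd := h3.trans d.adj.reachable
    exact h2 ⟨by simpa using h4, h1'.trans (SimpleGraph.Adj.reachable d.adj.1)⟩
  · intro p hp hf
    obtain ⟨h1, h2, h3⟩ := C.mem_boundary.mp hp
    simp only [Finset.mem_filter, Finset.mem_univ, true_and] at h1 h2
    exact h2 (h1.trans (SimpleGraph.Adj.reachable ((hG _ _).mpr ⟨h3, hlevel _ h1, hf⟩)))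

variable {C} {P : I → Prop} {ν : I → Fin 2 → ℝ} {D : C.V → Fin 2 → ℝ}

/-- If the deformations are the multiples of `D`, and all flags at a vertex which moves to the left
are horizontal, then this is the only vertex which moves. -/
theorem eq_zero_of_horizontal (hdef : C.IsDeformation P ν D)
    (huniq : ∀ D', C.IsDeformation P ν D' → ∃ c : ℝ, D' = c • D)
    (hcone : ∀ i, ¬ P i → D (C.mark i) 0 < 0 → D (C.mark i) 1 = 0)
    {v : C.V} (hv : D v 0 < 0) (hflag : ∀ w, C.graph.Adj v w → C.dir v w 1 = 0)
    {w : C.V} (hw : w ≠ v) : D w = 0 := by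
  classical
  have hne : ∀ x ≠ v, (Pi.single v ![1, 0] : C.V → Fin 2 → ℝ) x = 0 :=
    fun x hx => Pi.single_eq_of_ne hx _
  -- Moving `v` alone in the horizontal direction bends no edge, since all bounded flags at `v` are
  -- horizontal. Being a nonzero multiple of `D`, this deformation has the same support as `D`.
  have hD' : C.IsDeformation P ν (Pi.single v ![1, 0]) := by
    have hb : ∀ x y, C.graph.Adj x y → x = v → C.bend x y (Pi.single v ![1, 0]) = 0 := by
      rintro x y hxy rfl
      rw [bend_apply, hne y hxy.ne', Pi.single_eq_same, hflag y hxy]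
      simp
    refine ⟨fun x y hxy => ?_, fun i hi => hne _ ?_, fun i hi => ?_⟩
    · by_cases hx : x = v
      · exact hb x y hxy hx
      by_cases hy : y = v
      · rw [← C.bend_swap hxy]; exact hb y x hxy.symm hy
      · exact bend_eq_zero_of_eq (by rw [hne x hx, hne y hy])
    · rintro rfl
      rw [hdef.fixed i hi] at hv
      exact lt_irrefl _ hv
    -- A marking at `v` is moved by `D` in a horizontal direction, so its normal vector is vertical
    -- and permits every horizontal displacement.
    · by_cases hiv : C.mark i = v
      · have h1 := hdef.normal i hi
        rw [hcone i hi (hiv ▸ hv), mul_zero, add_zero] at h1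
        have h2 : ν i 0 = 0 := (mul_eq_zero.mp h1).resolve_right (hiv ▸ hv.ne)
        rw [hiv, Pi.single_eq_same, h2]
        simp
      · rw [hne _ hiv]; simp
  obtain ⟨c, hc⟩ := huniq _ hD'
  have hc0 : c ≠ 0 := by
    rintro rfl
    have := congrFun (congrFun hc v) 0
    simp at this
  have h1 := congrFun hc w
  rw [hne w hw] at h1
  exact (smul_eq_zero.mp h1.symm).resolve_left hc0

end PlaneTropicalCurve

theorem exists_eq_replicate {m : Multiset (Fin 2 → ℤ)} (h : ∀ e ∈ m, IsStandardDir e) :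
    ∃ p q s : ℕ, m = Multiset.replicate p ![-1, 0] + Multiset.replicate q ![0, -1]
      + Multiset.replicate s ![1, 1] := by
  induction m using Multiset.induction_on with
  | empty => exact ⟨0, 0, 0, by simp⟩
  | cons e m ih =>
    obtain ⟨p, q, s, rfl⟩ := ih fun e' he' => h e' (Multiset.mem_cons_of_mem he')
    rcases h e (Multiset.mem_cons_self _ _) with rfl | rfl | rfl
    · exact ⟨p + 1, q, s, by simp [Multiset.replicate_succ]⟩
    · exact ⟨p, q + 1, s, by simp [Multiset.replicate_succ]⟩
    · exact ⟨p, q, s + 1, by simp [Multiset.replicate_succ]⟩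

namespace PlaneTropicalCurve

variable {I : Type} [Fintype I] (C : PlaneTropicalCurve I)

theorem exists_map_endsIn (hends : ∀ u, IsStandardDir (C.endDir u)) (S : Finset C.V) :
    ∃ p q s : ℕ, (C.endsIn S).val.map C.endDir = Multiset.replicate p ![-1, 0]
      + Multiset.replicate q ![0, -1] + Multiset.replicate s ![1, 1] ∧
      (C.endsIn S).card = p + q + s ∧
      ∑ u ∈ C.endsIn S, C.endDir u 0 = s - p ∧ ∑ u ∈ C.endsIn S, C.endDir u 1 = s - q := by
  obtain ⟨p, q, s, h⟩ := exists_eq_replicate (m := (C.endsIn S).val.map C.endDir) (by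
    intro e he
    obtain ⟨u, -, rfl⟩ := Multiset.mem_map.mp he
    exact hends u)
  have hsum : ∀ j, ∑ u ∈ C.endsIn S, C.endDir u j
      = (((C.endsIn S).val.map C.endDir).map fun e => e j).sum := by
    intro j
    rw [Multiset.map_map]
    rfl
  refine ⟨p, q, s, h, ?_, ?_, ?_⟩
  · have := congrArg Multiset.card h
    simpa using this
  · rw [hsum, h]; simp; ring
  · rw [hsum, h]; simp; ring

theorem mem_map_endsIn {S : Finset C.V} {u : C.U} (hu : u ∈ C.endsIn S) :
    C.endDir u ∈ (C.endsIn S).val.map C.endDir := Multiset.mem_map_of_mem _ hu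

variable {C} {P : I → Prop} {ν : I → Fin 2 → ℝ} {D : C.V → Fin 2 → ℝ} {ℓ : Sym2 C.V → ℝ}

theorem eq_of_card_boundary_eq_one {S : Finset C.V} {v : C.V} (hS : S = {v})
    (hb : (C.boundary S).card = 1) {w w' : C.V} (hw : C.graph.Adj v w) (hw' : C.graph.Adj v w') :
    w = w' := by
  have hmem : ∀ x, C.graph.Adj v x → (v, x) ∈ C.boundary S := fun x hx => by
    rw [C.mem_boundary, hS]
    exact ⟨Finset.mem_singleton_self v, by simpa using hx.ne', hx⟩
  have := Finset.card_le_one.mp hb.le _ (hmem w hw) _ (hmem w' hw')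
  exact (Prod.mk.inj this).2

/-- If the deformations of a curve are the multiples of a deformation `D` which does not shorten any
bounded edge and which moves some vertex to the left, then only one vertex moves, and this
vertex is adjacent to only one bounded edge. -/
theorem exists_leaf_of_neg (hC : C.IsTrivalent) (hends : ∀ u, IsStandardDir (C.endDir u))
    (hℓ : ∀ v w, C.graph.Adj v w → 0 ≤ ℓ s(v, w))
    (hD : ∀ v w, C.graph.Adj v w → ∀ j, D w j - D v j = ℓ s(v, w) * (C.dir v w j : ℝ))
    (hdef : C.IsDeformation P ν D)
    (huniq : ∀ D', C.IsDeformation P ν D' → ∃ c : ℝ, D' = c • D) (hP : ∃ i, P i)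
    (hcone : ∀ i, ¬ P i → D (C.mark i) 0 < 0 → D (C.mark i) 1 = 0) (hneg : ∃ v, D v 0 < 0) :
    ∃ v, (∀ w, w ≠ v → D w = 0) ∧
      ∀ w w', C.graph.Adj v w → C.graph.Adj v w' → w = w' := by
  classical
  obtain ⟨v₁, hv₁⟩ := hneg
  obtain ⟨v₀, -, hmin⟩ := Finset.exists_min_image Finset.univ (fun v => D v 0)
    ⟨v₁, Finset.mem_univ _⟩
  replace hmin : ∀ v, D v₀ 0 ≤ D v 0 := fun v => hmin v (Finset.mem_univ _)
  have hv₀ : D v₀ 0 < 0 := (hmin v₁).trans_lt hv₁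
  -- `S` is a component of the set where the horizontal displacement attains its negative minimum.
  -- Fixed markings therefore lie outside `S`.
  obtain ⟨S, hv₀S, hSf, hS, hbd⟩ := C.exists_component (fun v => D v 0) v₀
  have hPS : ∀ i, P i → C.mark i ∉ S := fun i hi h => by
    have := hSf _ h
    rw [hdef.fixed i hi] at this
    exact hv₀.ne this.symm
  have hcard := C.card_add_two hC hS
  have hb : 0 < (C.boundary S).card := by
    obtain ⟨i, hi⟩ := hP
    exact Finset.card_pos.mpr (C.boundary_nonempty hv₀S (hPS i hi))
  -- Displacement increases strictly to the right across the boundary, and lengths do not decrease.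
  -- So boundary flags point to the right, by at least 1 because directions are integral.
  have hbpos : ∀ p ∈ C.boundary S, 0 < ℓ s(p.1, p.2) ∧ 1 ≤ C.dir p.1 p.2 0 := by
    intro p hp
    obtain ⟨h1, h2, h3⟩ := C.mem_boundary.mp hp
    have h4 := hD _ _ h3 0
    have h5 : D v₀ 0 < D p.2 0 := lt_of_le_of_ne (hmin _) (hbd p hp).symm
    rw [hSf _ h1] at h4
    have h6 := hℓ _ _ h3
    have h7 : 0 < ℓ s(p.1, p.2) * (C.dir p.1 p.2 0 : ℝ) := by linarith
    have h8 : (0 : ℝ) < C.dir p.1 p.2 0 := pos_of_mul_pos_right h7 h6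
    exact ⟨pos_of_mul_pos_left h7 h8.le, by exact_mod_cast h8⟩
  have hbsum : ((C.boundary S).card : ℤ) ≤ ∑ p ∈ C.boundary S, C.dir p.1 p.2 0 := by
    rw [Finset.card_eq_sum_ones, Nat.cast_sum]
    exact Finset.sum_le_sum fun p hp => by simpa using (hbpos p hp).2
  obtain ⟨p, q, s, hmap, hr, hx, hy⟩ := C.exists_map_endsIn hends S
  have hx0 := C.sum_boundary_apply S 0
  have hy0 := C.sum_boundary_apply S 1
  -- If all flags leaving `S` are horizontal, so are the edges inside `S`, and `v₀` is the only
  -- vertex that moves. Then `S = {v₀}`, and the three flags at `v₀` include at least as many ends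
  -- as boundary flags, so there is exactly one boundary flag.
  have hH : (∀ p ∈ C.boundary S, C.dir p.1 p.2 1 = 0) → (∀ u ∈ C.endsIn S, C.endDir u 1 = 0) →
      ∃ v, (∀ w, w ≠ v → D w = 0) ∧ ∀ w w', C.graph.Adj v w → C.graph.Adj v w' → w = w' := by
    intro h1 h2
    have h3 : ∀ w, w ≠ v₀ → D w = 0 := fun w hw =>
      eq_zero_of_horizontal hdef huniq hcone hv₀ (fun x hx => by
        by_cases hxS : x ∈ S
        · exact C.dir_apply_eq_zero h1 h2 hv₀S hxS hx
        · exact h1 (v₀, x) (C.mem_boundary.mpr ⟨hv₀S, hxS, hx⟩)) hw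
    have h4 : S = {v₀} := by
      refine Finset.eq_singleton_iff_unique_mem.mpr ⟨hv₀S, fun x hxS => ?_⟩
      by_contra hne
      have h5 : D x 0 = D v₀ 0 := hSf x hxS
      rw [h3 x hne] at h5
      exact hv₀.ne h5.symm
    refine ⟨v₀, h3, fun w w' => eq_of_card_boundary_eq_one h4 ?_⟩
    have h5 : S.card = 1 := by rw [h4, Finset.card_singleton]
    omega
  -- With three ends at `S` there would be a nonzero deformation that does not move `v₀`
  -- horizontally. It cannot be a multiple of `D`.
  have hr2 : (C.endsIn S).card ≤ 2 := by
    by_contra hlt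
    obtain ⟨D', hD'0, hD', -, hg⟩ := C.exists_isDeformation (P := P) (ν := ν) hC hS hPS (k := 1)
      (by omega) fun _ => coord v₀ 0
    obtain ⟨c, rfl⟩ := huniq D' hD'
    have h1 : c * D v₀ 0 = 0 := hg 0
    have h2 := (mul_eq_zero.mp h1).resolve_right hv₀.ne
    exact hD'0 (by rw [h2, zero_smul])
  have hends' : ∀ u ∈ C.endsIn S, (C.endDir u 1 = 0 ∧ 0 < p) ∨ (C.endDir u 1 = -1 ∧ 0 < q)
      ∨ 0 < s := by
    intro u hu
    have h1 := C.mem_map_endsIn hu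
    rw [hmap] at h1
    simp only [Multiset.mem_add, Multiset.mem_replicate, ne_eq] at h1
    rcases h1 with (⟨h1, h2⟩ | ⟨h1, h2⟩) | ⟨h1, h2⟩
    · exact Or.inl ⟨by rw [h2]; rfl, by omega⟩
    · exact Or.inr (Or.inl ⟨by rw [h2]; rfl, by omega⟩)
    · exact Or.inr (Or.inr (by omega))
  -- Horizontal balancing bounds the number of boundary flags by `p - s`. A single end must
  -- therefore have direction `(-1,0)`, with a single boundary flag, which is horizontal by vertical
  -- balancing.
  by_cases hr1 : (C.endsIn S).card = 1
  · have hb1 : (C.boundary S).card = 1 := by omega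
    obtain ⟨x, hxb⟩ := Finset.card_eq_one.mp hb1
    refine hH (fun y hyb => ?_) fun u hu => ?_
    · rw [hxb] at hyb hy0
      rw [Finset.sum_singleton] at hy0
      rw [Finset.mem_singleton.mp hyb]
      omega
    · rcases hends' u hu with h | h | h <;> omega
  have hr' : (C.endsIn S).card = 2 := by omega
  -- Here `p + q + s = 2` and `1 ≤ p - s`.
  have hs : s = 0 := by omega
  -- Two ends suffice for a nonzero deformation supported in `S`; by uniqueness `D` itself is
  -- supported there.
  have hsupp : ∀ v, v ∉ S → D v = 0 := by
    obtain ⟨D', hD'0, hD', hD'S, -⟩ := C.exists_isDeformation (P := P) (ν := ν) hC hS hPS (k := 0)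
      (by omega) Fin.elim0
    obtain ⟨c, rfl⟩ := huniq D' hD'
    intro v hv
    have h1 : c • D v = 0 := hD'S v hv
    exact (smul_eq_zero.mp h1).resolve_left fun h => hD'0 (by rw [h, zero_smul])
  have hbD : ∀ p ∈ C.boundary S, -D p.1 1 = ℓ s(p.1, p.2) * (C.dir p.1 p.2 1 : ℝ) := by
    intro p hp
    obtain ⟨h1, h2, h3⟩ := C.mem_boundary.mp hp
    rw [← hD _ _ h3 1, hsupp _ h2]
    simp
  obtain ⟨v₂, hv₂S, hmax⟩ := Finset.exists_max_image S (fun v => D v 1) ⟨v₀, hv₀S⟩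
  by_cases hM : 0 ≤ D v₂ 1
  -- `A` consists of the vertices of `S` that move furthest up. No flag leaving `A` points up:
  -- inside `S` by maximality, across the boundary of `S` because the outer vertices are fixed and
  -- `0 ≤ D v₂ 1`, and at ends because `s = 0`. Balancing makes all these flags horizontal, which
  -- forces `A = S`.
  · set A := S.filter fun v => D v 1 = D v₂ 1 with hA
    have hAS : A ⊆ S := Finset.filter_subset _ _
    have hAin : ∀ x ∈ C.boundary A, x.2 ∈ S → C.dir x.1 x.2 1 < 0 := by
      intro x hxA hx2
      obtain ⟨h1, h2, h3⟩ := C.mem_boundary.mp hxA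
      rw [hA, Finset.mem_filter] at h1 h2
      have h4 : D x.2 1 < D v₂ 1 := lt_of_le_of_ne (hmax _ hx2) fun h => h2 ⟨hx2, h⟩
      have h5 := hD _ _ h3 1
      rw [h1.2] at h5
      by_contra h6
      have h7 : (0 : ℝ) ≤ C.dir x.1 x.2 1 := by exact_mod_cast not_lt.mp h6
      have := mul_nonneg (hℓ _ _ h3) h7
      linarith
    have hAout : ∀ x ∈ C.boundary A, C.dir x.1 x.2 1 ≤ 0 := by
      intro x hxA
      by_cases hx2 : x.2 ∈ S
      · exact (hAin x hxA hx2).le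
      obtain ⟨h1, h2, h3⟩ := C.mem_boundary.mp hxA
      have hxS : x ∈ C.boundary S := C.mem_boundary.mpr ⟨hAS h1, hx2, h3⟩
      have h4 := hbD x hxS
      rw [(Finset.mem_filter.mp h1).2] at h4
      by_contra h5
      have h6 : (0 : ℝ) < C.dir x.1 x.2 1 := by exact_mod_cast not_le.mp h5
      have := mul_pos (hbpos x hxS).1 h6
      linarith
    have hAend : ∀ u ∈ C.endsIn A, C.endDir u 1 ≤ 0 := by
      intro u hu
      have h1 : u ∈ C.endsIn S := C.mem_endsIn.mpr (hAS (C.mem_endsIn.mp hu))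
      rcases hends' u h1 with h | h | h <;> omega
    have hsumA := C.sum_boundary_apply A 1
    have h1 := Finset.sum_nonpos hAout
    have h2 := Finset.sum_nonpos hAend
    have h3 := (Finset.sum_eq_zero_iff_of_nonpos hAout).mp (by omega)
    have h4 := (Finset.sum_eq_zero_iff_of_nonpos hAend).mp (by omega)
    have hAeq : A = S := by
      refine C.eq_of_closed hS hAS ⟨v₂, Finset.mem_filter.mpr ⟨hv₂S, rfl⟩⟩ fun v hv w hw hvw => ?_
      by_contra hwA
      have h5 : (v, w) ∈ C.boundary A := C.mem_boundary.mpr ⟨hv, hwA, hvw⟩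
      exact (hAin _ h5 hw).ne (h3 _ h5)
    rw [hAeq] at h3 h4
    exact hH h3 h4
  -- All of `S` moves down and to the left, so boundary flags also point up. Their number is at most
  -- both `p` and `q`, where `p + q = 2`, hence it is 1. A marking moving left would move
  -- horizontally, so there is none in `S`, and the count of flags gives a single vertex.
  · have hneg1 : ∀ v ∈ S, D v 1 < 0 := fun v hv => (hmax v hv).trans_lt (not_le.mp hM)
    have hbsum1 : ((C.boundary S).card : ℤ) ≤ ∑ p ∈ C.boundary S, C.dir p.1 p.2 1 := by
      rw [Finset.card_eq_sum_ones, Nat.cast_sum]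
      refine Finset.sum_le_sum fun x hx => ?_
      have h1 := hbD x hx
      have h2 := hneg1 _ (C.mem_boundary.mp hx).1
      by_contra h3
      have h4 : C.dir x.1 x.2 1 ≤ 0 := by push_cast at h3; omega
      have h5 : (C.dir x.1 x.2 1 : ℝ) ≤ 0 := by exact_mod_cast h4
      have := mul_nonpos_of_nonneg_of_nonpos (hbpos x hx).1.le h5
      linarith
    have hm : C.marksIn S = ∅ := by
      refine Finset.eq_empty_of_forall_notMem fun i hi => ?_
      rw [C.mem_marksIn] at hi
      have h1 : D (C.mark i) 0 = D v₀ 0 := hSf _ hi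
      exact (hneg1 _ hi).ne (hcone i (fun h => hPS i h hi) (h1 ▸ hv₀))
    rw [hm, Finset.card_empty] at hcard
    obtain ⟨v, hv⟩ := Finset.card_eq_one.mp (show S.card = 1 by omega)
    refine ⟨v, fun w hw => hsupp w (by rwa [hv, Finset.mem_singleton]), fun w w' =>
      eq_of_card_boundary_eq_one hv (by omega)⟩

end PlaneTropicalCurve

/-! ### Symmetries of the set of standard directions -/

/-- The linear map of the plane given by an integral matrix. -/
def act {R : Type} [Ring R] (T : Matrix (Fin 2) (Fin 2) ℤ) : (Fin 2 → R) →+ (Fin 2 → R) where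
  toFun v j := T j 0 * v 0 + T j 1 * v 1
  map_zero' := by funext j; simp
  map_add' v w := by funext j; simp only [Pi.add_apply, mul_add]; abel

theorem act_apply {R : Type} [Ring R] (T : Matrix (Fin 2) (Fin 2) ℤ) (v : Fin 2 → R) (j : Fin 2) :
    act T v j = T j 0 * v 0 + T j 1 * v 1 := rfl

theorem act_act {R : Type} [Ring R] (T T' : Matrix (Fin 2) (Fin 2) ℤ) (v : Fin 2 → R) :
    act T (act T' v) = act (T * T') v := by
  funext j
  simp only [act_apply, Matrix.mul_apply, Fin.sum_univ_two, Int.cast_add, Int.cast_mul, mul_add,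
    add_mul, mul_assoc]
  abel

theorem act_one {R : Type} [Ring R] (v : Fin 2 → R) : act 1 v = v := by
  funext j
  fin_cases j <;> simp [act_apply]

theorem act_smul (T : Matrix (Fin 2) (Fin 2) ℤ) (c : ℝ) (v : Fin 2 → ℝ) :
    act T (c • v) = c • act T v := by
  funext j
  simp only [act_apply, Pi.smul_apply, smul_eq_mul]
  ring

namespace PlaneTropicalCurve

variable {I : Type} [Fintype I] (C : PlaneTropicalCurve I)

/-- The image of a plane tropical curve under an integral linear map. -/
def transform (T : Matrix (Fin 2) (Fin 2) ℤ) : PlaneTropicalCurve I where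
  V := C.V
  U := C.U
  graph := C.graph
  isTree := C.isTree
  len := C.len
  len_pos := C.len_pos
  mark := C.mark
  endAt := C.endAt
  endDir := fun u => act T (C.endDir u)
  pos := fun v => act T (C.pos v)
  dir := fun v w => act T (C.dir v w)
  pos_sub := fun v w h j => by
    have h0 := C.pos_sub v w h 0
    have h1 := C.pos_sub v w h 1
    simp only [act_apply, Int.cast_add, Int.cast_mul, Int.cast_id]
    linear_combination (T j 0 : ℝ) * h0 + (T j 1 : ℝ) * h1
  balanced := fun v => by
    have h := congrArg (act T) (C.balanced v)
    rw [map_add, map_sum, map_sum, map_zero] at h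
    simpa only [apply_ite (act T), map_zero] using h
  three_le_valence := C.three_le_valence

variable {C} {P : I → Prop} {ν : I → Fin 2 → ℝ} {D : C.V → Fin 2 → ℝ} {ℓ : Sym2 C.V → ℝ}

/-- The determinant defining `bend` is multiplied by that of `T`. Normal vectors transform by the
transpose of the inverse, which is the transpose of `T` as `T` is an involution. -/
theorem IsDeformation.transform {T : Matrix (Fin 2) (Fin 2) ℤ} (hT : T * T = 1)
    (h : C.IsDeformation P ν D) : (C.transform T).IsDeformation P
      (fun i k => ν i 0 * T 0 k + ν i 1 * T 1 k) (fun v => act T (D v)) := by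
  refine ⟨fun v w hvw => ?_, fun i hi => ?_, fun i hi => ?_⟩
  · have h1 : (C.dir v w 0 : ℝ) * (D w 1 - D v 1) - C.dir v w 1 * (D w 0 - D v 0) = 0 :=
      h.bend_eq_zero v w hvw
    rw [bend_apply]
    simp only [PlaneTropicalCurve.transform, act_apply, Int.cast_add, Int.cast_mul, Int.cast_id]
    linear_combination ((T 0 0 : ℝ) * T 1 1 - T 0 1 * T 1 0) * h1
  · change act T (D (C.mark i)) = 0
    rw [h.fixed i hi, map_zero]
  · have h1 := h.normal i hi
    have h2 : act T (act T (D (C.mark i))) = D (C.mark i) := by rw [act_act, hT, act_one]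
    rw [← h2] at h1
    change _ * act T (D (C.mark i)) 0 + _ * act T (D (C.mark i)) 1 = 0
    generalize act T (D (C.mark i)) = x at h1
    simp only [act_apply] at h1
    linear_combination h1

/-- All hypotheses are carried over to the image curve under `T`, so that a vertex moving in any of
the directions related by symmetry can be treated as moving to the left. -/
theorem exists_leaf_of_act_neg {T : Matrix (Fin 2) (Fin 2) ℤ} (hT : T * T = 1)
    (hstd : ∀ e, IsStandardDir e → IsStandardDir (act T e))
    (hC : C.IsTrivalent) (hends : ∀ u, IsStandardDir (C.endDir u))
    (hℓ : ∀ v w, C.graph.Adj v w → 0 ≤ ℓ s(v, w))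
    (hD : ∀ v w, C.graph.Adj v w → ∀ j, D w j - D v j = ℓ s(v, w) * (C.dir v w j : ℝ))
    (hdef : C.IsDeformation P ν D)
    (huniq : ∀ D', C.IsDeformation P ν D' → ∃ c : ℝ, D' = c • D) (hP : ∃ i, P i)
    (hcone : ∀ i, ¬ P i → ∃ s : ℝ, 0 ≤ s ∧ ∃ e, IsStandardDir e ∧
      D (C.mark i) = fun j => s * (e j : ℝ)) (hneg : ∃ v, act T (D v) 0 < 0) :
    ∃ v, (∀ w, w ≠ v → D w = 0) ∧
      ∀ w w', C.graph.Adj v w → C.graph.Adj v w' → w = w' := by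
  have hTT : ∀ x : Fin 2 → ℝ, act T (act T x) = x := fun x => by rw [act_act, hT, act_one]
  have main := exists_leaf_of_neg (C := C.transform T) (P := P) (ℓ := ℓ)
    (ν := fun i k => ν i 0 * T 0 k + ν i 1 * T 1 k) (D := fun v => act T (D v))
    hC (fun u => hstd _ (hends u)) hℓ (fun v w hvw j => ?_) (hdef.transform hT)
    (fun D' hD' => ?_) hP (fun i hi hlt => ?_) hneg
  · obtain ⟨v, h1, h2⟩ := main
    refine ⟨v, fun w hw => ?_, h2⟩
    rw [← hTT (D w)]
    exact (congrArg (act T) (h1 w hw)).trans (map_zero _)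
  · have h0 := hD v w hvw 0
    have h1 := hD v w hvw 1
    simp only [PlaneTropicalCurve.transform, act_apply, Int.cast_add, Int.cast_mul, Int.cast_id]
    linear_combination (T j 0 : ℝ) * h0 + (T j 1 : ℝ) * h1
  · have h3 : C.IsDeformation P ν fun v => act T (D' v) := by
      have h4 := hD'.transform hT
      refine ⟨fun v w hvw => ?_, h4.fixed, fun i hi => ?_⟩
      · have h5 : ((act T (act T (C.dir v w)) 0 : ℤ) : ℝ) * (act T (D' w) 1 - act T (D' v) 1)
            - ((act T (act T (C.dir v w)) 1 : ℤ) : ℝ) * (act T (D' w) 0 - act T (D' v) 0) = 0 :=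
          h4.bend_eq_zero v w hvw
        rw [act_act, hT, act_one] at h5
        exact h5
      · have h5 := hD'.normal i hi
        change _ * D' (C.mark i) 0 + _ * D' (C.mark i) 1 = 0 at h5
        simp only [act_apply]
        linear_combination h5
    obtain ⟨c, hc⟩ := huniq _ h3
    refine ⟨c, funext fun (v : C.V) => ?_⟩
    have h5 : act T (D' v) = c • D v := congrFun hc v
    change D' v = c • act T (D v)
    rw [← hTT (D' v), h5, act_smul]
  · obtain ⟨s, hs, e, he, hse⟩ := hcone i hi
    have h3 : ∀ j, act T (D (C.mark i)) j = s * ((act T e j : ℤ) : ℝ) := fun j => by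
      rw [hse]
      simp only [act_apply, Int.cast_add, Int.cast_mul, Int.cast_id]
      ring
    change act T (D (C.mark i)) 0 < 0 at hlt
    change act T (D (C.mark i)) 1 = 0
    rw [h3] at hlt ⊢
    -- Only `(-1,0)` among the standard directions has a negative first coordinate.
    rcases hstd e he with h4 | h4 | h4 <;> rw [h4] at hlt ⊢
    · simp
    · simp at hlt
    · simp at hlt; linarith

/-- If the deformations of a curve are the multiples of a nonzero deformation which does not shorten
any bounded edge, then only one vertex moves, and this vertex is adjacent to only one bounded edge. -/
theorem exists_leaf (hC : C.IsTrivalent) (hends : ∀ u, IsStandardDir (C.endDir u))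
    (hℓ : ∀ v w, C.graph.Adj v w → 0 ≤ ℓ s(v, w))
    (hD : ∀ v w, C.graph.Adj v w → ∀ j, D w j - D v j = ℓ s(v, w) * (C.dir v w j : ℝ))
    (hdef : C.IsDeformation P ν D)
    (huniq : ∀ D', C.IsDeformation P ν D' → ∃ c : ℝ, D' = c • D) (hP : ∃ i, P i)
    (hcone : ∀ i, ¬ P i → ∃ s : ℝ, 0 ≤ s ∧ ∃ e, IsStandardDir e ∧
      D (C.mark i) = fun j => s * (e j : ℝ)) (hne : D ≠ 0) :
    ∃ v, (∀ w, w ≠ v → D w = 0) ∧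
      ∀ w w', C.graph.Adj v w → C.graph.Adj v w' → w = w' := by
  by_contra hcon
  have key : ∀ T : Matrix (Fin 2) (Fin 2) ℤ, T * T = 1 →
      (∀ e, IsStandardDir e → IsStandardDir (act T e)) → ∀ v, 0 ≤ act T (D v) 0 := by
    intro T hT hstd v
    by_contra hlt
    exact hcon (exists_leaf_of_act_neg hT hstd hC hends hℓ hD hdef huniq hP hcone
      ⟨v, not_le.mp hlt⟩)
  -- These involutions permute `(-1,0)`, `(0,-1)`, `(1,1)`. If no image moves left, a displacement
  -- `(x, y)` satisfies `0 ≤ x`, `0 ≤ y`, `0 ≤ -x` and `0 ≤ x - y`, hence is zero.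
  have h1 := key 1 (by simp) (fun e he => by rwa [act_one])
  have h2 := key !![0, 1; 1, 0] (by decide) (by
    rintro e (rfl | rfl | rfl) <;> simp [IsStandardDir, funext_iff, act_apply, Fin.forall_fin_two])
  have h3 := key !![-1, 0; -1, 1] (by decide) (by
    rintro e (rfl | rfl | rfl) <;> simp [IsStandardDir, funext_iff, act_apply, Fin.forall_fin_two])
  have h4 := key !![1, -1; 0, -1] (by decide) (by
    rintro e (rfl | rfl | rfl) <;> simp [IsStandardDir, funext_iff, act_apply, Fin.forall_fin_two])
  simp only [act_apply, Matrix.one_apply, Matrix.of_apply, Matrix.cons_val_zero,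
    Matrix.cons_val_one] at h1 h2 h3 h4
  apply hne
  funext v j
  have e1 := h1 v
  have e2 := h2 v
  have e3 := h3 v
  have e4 := h4 v
  norm_num at e1 e2 e3 e4
  have e5 : D v 0 = 0 := le_antisymm e3 e1
  fin_cases j
  · exact e5
  · exact le_antisymm (e4.trans e5.le) e2

end PlaneTropicalCurve

/-! ### Nonzero multiplicity as injectivity on infinitesimal deformations -/

open Classical in
theorem sum_filter_edge_mul {V : Type} {G : SimpleGraph V} [Fintype G.edgeSet] (L : List G.Dart)
    (f : G.Dart → ℝ) (ℓ : Sym2 V → ℝ) :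
    ∑ e : G.edgeSet, ((L.filter fun d => d.edge = e.1).map f).sum * ℓ e.1
      = (L.map fun d => f d * ℓ d.edge).sum := by
  induction L with
  | nil => simp
  | cons d L ih =>
    rw [List.map_cons, List.sum_cons, ← ih]
    have h1 : ∀ e : G.edgeSet, (((d :: L).filter fun d => d.edge = e.1).map f).sum * ℓ e.1
        = (if (⟨d.edge, d.edge_mem⟩ : G.edgeSet) = e then f d * ℓ d.edge else 0)
          + ((L.filter fun d => d.edge = e.1).map f).sum * ℓ e.1 := by
      intro e
      by_cases he : d.edge = e.1
      · rw [List.filter_cons_of_pos (by simpa using he), List.map_cons, List.sum_cons,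
          if_pos (Subtype.ext he), he]
        ring
      · rw [List.filter_cons_of_neg (by simpa using he), if_neg fun h => he (congrArg Subtype.val h),
          zero_add]
    rw [Finset.sum_congr rfl fun e _ => h1 e, Finset.sum_add_distrib]
    simp

theorem PlaneTropicalCurve.sum_darts {I : Type} [Fintype I] (C : PlaneTropicalCurve I)
    {D : C.V → Fin 2 → ℝ} {ℓ : Sym2 C.V → ℝ}
    (hD : ∀ v w, C.graph.Adj v w → ∀ j, D w j - D v j = ℓ s(v, w) * (C.dir v w j : ℝ))
    {v w : C.V} (p : C.graph.Walk v w) (j : Fin 2) :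
    (p.darts.map fun d => (C.dir d.fst d.snd j : ℝ) * ℓ d.edge).sum = D w j - D v j := by
  induction p with
  | nil => simp
  | cons h p ih =>
    rw [SimpleGraph.Walk.darts_cons, List.map_cons, List.sum_cons, ih]
    have h1 := hD _ _ h j
    change _ * ℓ s(_, _) + _ = _
    linarith

namespace Domain

variable {d n l : ℕ} {hn : 4 ≤ n} {a : ℕ × ℕ → ℝ} (C : Domain d n hn l a)

/-- The markings `x₃, …, x_n`, which are mapped to given points. -/
def IsPointMarking (i : Fin n) : Prop := 2 ≤ (i : ℕ)

/-- The normal vectors of the edges through the images of the markings. -/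
noncomputable def normal (i : Fin n) (j : Fin 2) : ℝ := edgeNormal l a (C.ev i) j

open Classical in
theorem card_of_mult_ne_zero (h : C.mult ≠ 0) :
    Fintype.card (Row n) = Fintype.card C.Coordinate := by
  by_contra hne
  exact h (by rw [mult, dif_neg hne])

open Classical in
theorem eq_zero_of_matrix (h : C.mult ≠ 0) {x : C.Coordinate → ℝ}
    (hx : ∀ r, ∑ c, C.matrix r c * x c = 0) : x = 0 := by
  rw [mult, dif_pos (C.card_of_mult_ne_zero h)] at h
  have h1 := abs_ne_zero.mp h
  generalize_proofs hcard at h1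
  set e := Fintype.equivOfCardEq hcard
  have h2 : (C.matrix.submatrix id e).mulVec (x ∘ e) = 0 := by
    rw [Matrix.submatrix_mulVec_equiv]
    funext r
    simpa [Matrix.mulVec, dotProduct, Function.comp_def] using hx r
  have h3 := Matrix.eq_zero_of_mulVec_eq_zero h1 h2
  funext c
  simpa using congrFun h3 (e.symm c)

/-- The vector of coordinates of a displacement of the vertices with a change of lengths. -/
def coordinates (D : C.V → Fin 2 → ℝ) (ℓ : Sym2 C.V → ℝ) : C.Coordinate → ℝ :=
  Sum.elim (D (C.mark (firstFour hn 0))) fun e => ℓ e.1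

-- The contributions of the edges telescope along the path from the root to `v`. Thus the rows of
-- the matrix, applied to the coordinates of a deformation, evaluate the displacements of the
-- vertices.
open Classical in
theorem sum_posCoeff_mul {D : C.V → Fin 2 → ℝ} {ℓ : Sym2 C.V → ℝ}
    (hD : ∀ v w, C.graph.Adj v w → ∀ j, D w j - D v j = ℓ s(v, w) * (C.dir v w j : ℝ))
    (v : C.V) (j : Fin 2) : ∑ c, C.posCoeff v j c * C.coordinates D ℓ c = D v j := by
  have h1 := sum_filter_edge_mul (C.pathTo v).darts (fun d => (C.dir d.fst d.snd j : ℝ)) ℓ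
  rw [C.sum_darts hD] at h1
  rw [Fintype.sum_sum_type]
  simp only [posCoeff, coordinates, Sum.elim_inl, Sum.elim_inr]
  have h2 : ∑ k : Fin 2, (if k = j then (1 : ℝ) else 0) * D (C.mark (firstFour hn 0)) k
      = D (C.mark (firstFour hn 0)) j := by simp
  rw [h2, ← eq_sub_iff_add_eq']
  convert h1

open Classical in
/-- If the multiplicity is nonzero, then `π̃` is injective on infinitesimal deformations. -/
theorem eq_zero_of_mult_ne_zero (h : C.mult ≠ 0) {D : C.V → Fin 2 → ℝ} {ℓ : Sym2 C.V → ℝ}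
    (hD : ∀ v w, C.graph.Adj v w → ∀ j, D w j - D v j = ℓ s(v, w) * (C.dir v w j : ℝ))
    (hP : ∀ i, IsPointMarking i → D (C.mark i) = 0)
    (hν : ∀ i, ¬ IsPointMarking i →
      C.normal i 0 * D (C.mark i) 0 + C.normal i 1 * D (C.mark i) 1 = 0)
    (hδ : ∑ e : C.graph.edgeSet, C.forgetCoeff (Sum.inr e) * ℓ e.1 = 0) :
    D = 0 ∧ ∀ e ∈ C.graph.edgeSet, ℓ e = 0 := by
  have hx : C.coordinates D ℓ = 0 := by
    refine C.eq_zero_of_matrix h fun r => ?_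
    rcases r with i | ⟨i, j⟩ | u
    · simp only [matrix, Finset.sum_mul]
      rw [Finset.sum_comm]
      simp only [mul_assoc, ← Finset.mul_sum, C.sum_posCoeff_mul hD]
      rw [Fin.sum_univ_two]
      exact hν _ (by simp [IsPointMarking]; omega)
    · simp only [matrix, C.sum_posCoeff_mul hD]
      rw [hP i.1 i.2]
      rfl
    · simp only [matrix]
      rw [Fintype.sum_sum_type]
      simp only [forgetCoeff, zero_mul, Finset.sum_const_zero, zero_add]
      simpa only [forgetCoeff, coordinates, Sum.elim_inr] using hδ
  refine ⟨funext fun v => funext fun j => ?_, fun e he => congrFun hx (Sum.inr ⟨e, he⟩)⟩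
  rw [← C.sum_posCoeff_mul hD v j, hx]
  simp

-- Two point markings at one vertex would give equal rows in the matrix.
open Classical in
theorem mark_injective_of_mult_ne_zero (h : C.mult ≠ 0) {i i' : Fin n} (hi : IsPointMarking i)
    (hi' : IsPointMarking i') (hm : C.mark i = C.mark i') : i = i' := by
  by_contra hne
  apply h
  rw [mult, dif_pos (C.card_of_mult_ne_zero h), abs_eq_zero]
  refine Matrix.det_zero_of_row_eq (i := Sum.inr (Sum.inl (⟨i, hi⟩, 0)))
    (j := Sum.inr (Sum.inl (⟨i', hi'⟩, 0))) (fun heq => hne (by simpa [Subtype.ext_iff] using heq)) ?_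
  funext c
  simp only [Matrix.submatrix_apply, matrix, id_eq]
  rw [hm]

end Domain

/-! ### Edges that separate the four markings -/

namespace PlaneTropicalCurve

variable {I : Type} [Fintype I] (C : PlaneTropicalCurve I)

/-- An edge which separates two markings lies on each walk between them. -/
theorem reachable_deleteEdges_of_not {x y : C.V} {e f : Sym2 C.V}
    (hf : ¬ (C.graph.deleteEdges {f}).Reachable x y) (he : (C.graph.deleteEdges {e}).Reachable x y)
    {z : C.V} (hz : z ∈ f) : (C.graph.deleteEdges {e}).Reachable x z := by
  classical
  obtain ⟨p⟩ := he
  have h1 : f ∈ p.edges := by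
    by_contra hn
    apply hf
    refine ⟨(p.mapLe (SimpleGraph.deleteEdges_le _)).toDeleteEdges {f} fun g hg => ?_⟩
    rintro rfl
    rw [SimpleGraph.Walk.edges_mapLe_eq_edges] at hg
    exact hn hg
  have h2 : z ∈ p.support := SimpleGraph.Walk.mem_support_of_mem_edges h1 hz
  exact ⟨p.takeUntil z h2⟩

/-- The four-point condition: an edge which separates `i`, `j` from `k`, `m` and an edge which
separates `i`, `k` from `j`, `m` do not exist at the same time. -/
theorem not_separates {e f : Sym2 C.V} {i j k m : I} (he : C.Separates e i j k m) :
    ¬ C.Separates f i k j m := by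
  intro hf
  obtain ⟨e1, e2, e3⟩ := he
  obtain ⟨f1, f2, f3⟩ := hf
  -- The edge `f` separates `i` from `j` and `k` from `m`, so it lies on the walks between them that
  -- avoid `e`. An end of `f` then connects `i` to `k` without using `e`.
  have hz : (Quot.out f).1 ∈ f := Sym2.out_fst_mem f
  refine e3 ((C.reachable_deleteEdges_of_not f3 e1 hz).trans ?_)
  refine (C.reachable_deleteEdges_of_not (fun h => f3 ?_) e2 hz).symm
  exact f1.trans (h.trans f2.symm)

theorem Separates.swap {e : Sym2 C.V} {i j k m : I} (h : C.Separates e i j k m) :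
    C.Separates e i j m k := ⟨h.1, h.2.1.symm, fun h' => h.2.2 (h'.trans h.2.1.symm)⟩

end PlaneTropicalCurve

/-! ### Geometry of a contracted bounded edge -/

namespace PlaneTropicalCurve

variable {I : Type} [Fintype I] {C : PlaneTropicalCurve I}

variable (C) in
/-- The removal of an edge leaves two components. -/
theorem reachable_or_reachable (v w z : C.V) :
    (C.graph.deleteEdges {s(v, w)}).Reachable v z ∨
      (C.graph.deleteEdges {s(v, w)}).Reachable w z := by
  by_contra hz
  obtain ⟨p⟩ := C.isTree.connected.preconnected v z
  obtain ⟨d, -, h3, h4⟩ := p.exists_boundary_dart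
    {z | (C.graph.deleteEdges {s(v, w)}).Reachable v z ∨
      (C.graph.deleteEdges {s(v, w)}).Reachable w z} (Or.inl (SimpleGraph.Reachable.refl _)) hz
  by_cases he : s(d.fst, d.snd) = s(v, w)
  · rcases Sym2.eq_iff.mp he with h5 | h5
    · exact h4 (Or.inr (by rw [h5.2]))
    · exact h4 (Or.inl (by rw [h5.2]))
  · have h5 : (C.graph.deleteEdges {s(v, w)}).Adj d.fst d.snd := by
      rw [SimpleGraph.deleteEdges_adj]
      exact ⟨d.adj, he⟩
    exact h4 (h3.imp (fun h => h.trans h5.reachable) fun h => h.trans h5.reachable)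

/-- A displacement of the vertices is the displacement for a change of the lengths. -/
theorem exists_len {D : C.V → Fin 2 → ℝ} (hD : ∀ v w, C.graph.Adj v w → C.bend v w D = 0)
    (hD0 : ∀ v w, C.graph.Adj v w → C.dir v w = 0 → D v = D w) :
    ∃ ℓ : Sym2 C.V → ℝ, ∀ v w, C.graph.Adj v w → ∀ j,
      D w j - D v j = ℓ s(v, w) * (C.dir v w j : ℝ) := by
  -- The coefficient of the orthogonal projection of the relative displacement to the direction; it
  -- does not depend on the orientation. On a contracted edge the quotient is 0 by convention, and
  -- any value would do there.
  let r : C.V → C.V → ℝ := fun v w =>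
    ((D w 0 - D v 0) * C.dir v w 0 + (D w 1 - D v 1) * C.dir v w 1)
      / ((C.dir v w 0 : ℝ) ^ 2 + (C.dir v w 1 : ℝ) ^ 2)
  have hr : ∀ v w, C.graph.Adj v w → r w v = r v w := by
    intro v w hvw
    simp only [r, C.dir_swap hvw, Pi.neg_apply, Int.cast_neg]
    congr 1 <;> ring
  refine ⟨fun e => r (Quot.out e).1 (Quot.out e).2, fun v w hvw j => ?_⟩
  have h1 : r (Quot.out s(v, w)).1 (Quot.out s(v, w)).2 = r v w := by
    generalize hq : Quot.out s(v, w) = q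
    have h2 : s(q.1, q.2) = s(v, w) := by rw [← hq]; exact Quot.out_eq _
    rcases Sym2.eq_iff.mp h2 with ⟨h3, h4⟩ | ⟨h3, h4⟩
    · rw [h3, h4]
    · rw [h3, h4, hr v w hvw]
  beta_reduce
  rw [h1]
  by_cases h0 : C.dir v w = 0
  · rw [hD0 v w hvw h0, h0]; simp
  · have h2 : (C.dir v w 0 : ℝ) ^ 2 + (C.dir v w 1 : ℝ) ^ 2 ≠ 0 := by
      intro h3
      apply h0
      have h4 : (C.dir v w 0 : ℝ) = 0 := by
        nlinarith [sq_nonneg (C.dir v w 0 : ℝ), sq_nonneg (C.dir v w 1 : ℝ)]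
      have h5 : (C.dir v w 1 : ℝ) = 0 := by
        nlinarith [sq_nonneg (C.dir v w 0 : ℝ), sq_nonneg (C.dir v w 1 : ℝ)]
      funext j
      fin_cases j
      · exact_mod_cast h4
      · exact_mod_cast h5
    have h3 := hD v w hvw
    rw [bend_apply] at h3
    simp only [r]
    rw [div_mul_eq_mul_div, eq_div_iff h2]
    fin_cases j
    · simp only [Fin.zero_eta]; linear_combination (-(C.dir v w 1 : ℝ)) * h3
    · simp only [Fin.mk_one]; linear_combination (C.dir v w 0 : ℝ) * h3

namespace ContractedEdge

variable (E : C.ContractedEdge)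

open Classical in
/-- The vertices on the side of `E.fst`. -/
noncomputable def sideFinset : Finset C.V := Finset.univ.filter fun v => v ∈ E.side

theorem mem_sideFinset {v : C.V} : v ∈ E.sideFinset ↔ v ∈ E.side := by simp [sideFinset]

theorem coe_sideFinset : (E.sideFinset : Set C.V) = E.side := by simp [sideFinset]

theorem isTree_sideFinset : (C.graph.induce (E.sideFinset : Set C.V)).IsTree := by
  rw [coe_sideFinset]; exact E.isTree_induce

theorem mem_symm_side {v : C.V} : v ∈ E.symm.side ↔ v ∉ E.side := by
  have hs : E.symm.side = {v | (C.graph.deleteEdges {s(E.fst, E.snd)}).Reachable E.snd v} := by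
    simp only [side, symm, Sym2.eq_swap (a := E.snd)]
  rw [hs]
  constructor
  · intro h1 h2
    exact E.snd_notMem ((show (C.graph.deleteEdges {s(E.fst, E.snd)}).Reachable E.fst v from
      h2).trans h1.symm)
  · intro h1
    by_contra h2
    exact (C.reachable_or_reachable E.fst E.snd v).elim h1 h2

open Classical in
theorem sideFinset_symm : E.symm.sideFinset = E.sideFinsetᶜ := by
  ext v
  rw [Finset.mem_compl, mem_sideFinset, mem_sideFinset, mem_symm_side]

theorem boundary_sideFinset : C.boundary E.sideFinset = {(E.fst, E.snd)} := by
  ext ⟨v, w⟩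
  rw [C.mem_boundary, mem_sideFinset, mem_sideFinset, Finset.mem_singleton, Prod.mk.injEq]
  constructor
  · rintro ⟨h1, h2, h3⟩
    exact E.eq_of_adj h1 h2 h3
  · rintro ⟨rfl, rfl⟩
    exact ⟨E.fst_mem, E.snd_notMem, E.adj⟩

/-- `E` is the only contracted bounded edge. -/
def IsUnique : Prop := ∀ v w, C.graph.Adj v w → C.dir v w = 0 → s(v, w) = s(E.fst, E.snd)

variable {E}

theorem IsUnique.symm (h : E.IsUnique) : E.symm.IsUnique :=
  fun v w hvw h0 => (h v w hvw h0).trans Sym2.eq_swap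

open Classical in
theorem card_filter_valence (hC : C.IsTrivalent) (v : C.V) :
    (Finset.univ.filter fun w => C.graph.Adj v w).card
      + (Finset.univ.filter fun u => C.endAt u = v).card
      + (Finset.univ.filter fun i => C.mark i = v).card = 3 := by
  have h := hC v
  simp only [valence, Finset.sum_boole, Nat.cast_id] at h
  exact h

open Classical in
theorem sum_filter_balanced (v : C.V) :
    ∑ w ∈ Finset.univ.filter (fun w => C.graph.Adj v w), C.dir v w
    + ∑ u ∈ Finset.univ.filter (fun u => C.endAt u = v), C.endDir u = 0 := by
  rw [Finset.sum_filter, Finset.sum_filter]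
  exact C.balanced v

/-- The flags at an end of a contracted edge are parallel. -/
theorem exists_parallel (hC : C.IsTrivalent) (hE : E.IsUnique) : ∃ u : Fin 2 → ℤ, u ≠ 0 ∧
    ∀ w, C.graph.Adj E.snd w → w ≠ E.fst → C.dir E.snd w 0 * u 1 = C.dir E.snd w 1 * u 0 := by
  classical
  by_cases hw : ∃ w, C.graph.Adj E.snd w ∧ w ≠ E.fst
  swap
  -- Without further bounded flags at `E.snd` any nonzero vector serves.
  · exact ⟨![1, 0], fun h => by simpa using congrFun h 0, fun w h1 h2 => absurd ⟨w, h1, h2⟩ hw⟩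
  obtain ⟨w₁, h1, h1'⟩ := hw
  refine ⟨C.dir E.snd w₁, fun h0 => ?_, fun w h2 h2' => ?_⟩
  · have := hE _ _ h1 h0
    rw [Sym2.eq_swap, Sym2.congr_left] at this
    exact h1' this
  by_cases hne : w = w₁
  · rw [hne, mul_comm]
  have hcard := card_filter_valence hC E.snd
  have hsum := sum_filter_balanced E.snd
  have hsub : ({E.fst, w₁, w} : Finset C.V) ⊆ Finset.univ.filter fun w => C.graph.Adj E.snd w := by
    intro x hx
    simp only [Finset.mem_insert, Finset.mem_singleton] at hx
    rcases hx with rfl | rfl | rfl <;> simp [E.adj.symm, h1, h2]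
  have hc3 : ({E.fst, w₁, w} : Finset C.V).card = 3 :=
    Finset.card_eq_three.mpr ⟨_, _, _, h1'.symm, h2'.symm, Ne.symm hne, rfl⟩
  have heq := Finset.eq_of_subset_of_card_le hsub (by omega)
  -- With two further bounded edges the trivalent vertex `E.snd` has no other flags, so balancing
  -- makes these two opposite.
  have hends : (Finset.univ.filter fun u => C.endAt u = E.snd) = ∅ := by
    rw [← Finset.card_eq_zero]
    have := Finset.card_le_card hsub
    omega
  rw [hends, ← heq, Finset.sum_empty, add_zero, Finset.sum_insert, Finset.sum_insert,
    Finset.sum_singleton, C.dir_swap E.adj, E.dir_eq_zero, neg_zero, zero_add] at hsum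
  · have e0 : C.dir E.snd w₁ 0 + C.dir E.snd w 0 = 0 := congrFun hsum 0
    have e1 : C.dir E.snd w₁ 1 + C.dir E.snd w 1 = 0 := congrFun hsum 1
    linear_combination C.dir E.snd w₁ 1 * e0 - C.dir E.snd w₁ 0 * e1
  · simpa using Ne.symm hne
  · simp [h1'.symm, h2'.symm]

open Classical in
/-- If the only deformation for which `E` stays contracted is zero, then there are not too few
conditions on one side of `E`. -/
theorem card_sideFinset_le {P : I → Prop} {ν : I → Fin 2 → ℝ} (hC : C.IsTrivalent)
    (hE : E.IsUnique) (hinj : ∀ D, C.IsDeformation P ν D → D E.fst = D E.snd → D = 0)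
    (hmark : ∀ i, C.mark i ≠ E.snd) : E.sideFinset.card
      ≤ 2 * ((C.marksIn E.sideFinset).filter P).card
        + ((C.marksIn E.sideFinset).filter fun i => ¬ P i).card := by
  by_contra hlt
  obtain ⟨u, hu0, hu⟩ := exists_parallel hC hE
  set S := E.sideFinset with hS
  have hfst : E.fst ∈ S := E.mem_sideFinset.mpr E.fst_mem
  have hsnd : E.snd ∉ S := fun h => E.snd_notMem (E.mem_sideFinset.mp h)
  have h2 := C.card_edgeSet_induce (S := S) E.isTree_sideFinset
  -- The side `S` moves together with `E.snd`, all else being fixed: `2 * (S.card + 1)` unknowns.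
  -- Besides the `S.card - 1` edges and the markings there are three conditions: two keep `E`
  -- contracted and one makes `E.snd` move along `u`. The last one leaves the edges beyond `E.snd`
  -- straight although their other ends are fixed.
  obtain ⟨D, hD0, hDS, hD⟩ := exists_ne_zero_of_card_lt
    (J := (C.graph.induce (S : Set C.V)).edgeSet ⊕ ((C.marksIn S).filter P × Fin 2)
      ⊕ ((C.marksIn S).filter fun i => ¬ P i) ⊕ Fin 2 ⊕ Unit) (insert E.snd S)
    (Sum.elim (C.edgeBend S) (Sum.elim (fun i => coord (C.mark i.1) i.2)
      (Sum.elim (fun i => C.normalCond ν i) (Sum.elim (fun j => coord E.fst j - coord E.snd j)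
        fun _ => (u 1 : ℝ) • coord E.snd 0 - (u 0 : ℝ) • coord E.snd 1)))) (by
    simp only [Fintype.card_sum, Fintype.card_coe, Fintype.card_fin, Fintype.card_prod,
      Fintype.card_unit]
    rw [Finset.card_insert_of_notMem hsnd]
    omega)
  have hsame : D E.fst = D E.snd := funext fun j =>
    sub_eq_zero.mp (hD (Sum.inr (Sum.inr (Sum.inr (Sum.inl j)))))
  have hpar : (u 1 : ℝ) * D E.snd 0 - u 0 * D E.snd 1 = 0 :=
    hD (Sum.inr (Sum.inr (Sum.inr (Sum.inr ()))))
  have hDS' : ∀ v, v ∉ S → v ≠ E.snd → D v = 0 := fun v h1 h2 =>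
    hDS v (by rw [Finset.mem_insert, not_or]; exact ⟨h2, h1⟩)
  have hmem : ∀ v ∈ S, ∀ w, C.graph.Adj v w → C.bend v w D = 0 := by
    intro v hv w hvw
    by_cases hw : w ∈ S
    · exact C.bend_eq_zero_of_edgeBend (fun e => hD (Sum.inl e)) hv hw hvw
    · obtain ⟨rfl, rfl⟩ := E.eq_of_adj (E.mem_sideFinset.mp hv)
        (fun h => hw (E.mem_sideFinset.mpr h)) hvw
      exact bend_eq_zero_of_eq hsame
  have hb : ∀ w, C.graph.Adj E.snd w → C.bend E.snd w D = 0 := by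
    intro w hw
    by_cases hwS : w ∈ S
    · rw [← C.bend_swap hw]; exact hmem w hwS _ hw.symm
    · have h3 : (C.dir E.snd w 0 : ℝ) * u 1 = C.dir E.snd w 1 * u 0 := by
        exact_mod_cast hu w hw (fun h => hwS (h ▸ hfst))
      rw [bend_apply, hDS' w hwS hw.ne']
      simp only [Pi.zero_apply, zero_sub]
      have h4 : u 0 ≠ 0 ∨ u 1 ≠ 0 := by
        by_contra h5
        push Not at h5
        exact hu0 (funext fun j => by fin_cases j <;> simp [h5])
      rcases h4 with h4 | h4
      · have h5 : (u 0 : ℝ) ≠ 0 := by exact_mod_cast h4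
        apply mul_left_cancel₀ h5
        linear_combination (-(D E.snd 0)) * h3 + (C.dir E.snd w 0 : ℝ) * hpar
      · have h5 : (u 1 : ℝ) ≠ 0 := by exact_mod_cast h4
        apply mul_left_cancel₀ h5
        linear_combination (-(D E.snd 1)) * h3 + (C.dir E.snd w 1 : ℝ) * hpar
  refine hD0 (hinj D ⟨fun v w hvw => ?_, fun i hi => ?_, fun i hi => ?_⟩ hsame)
  · by_cases hv : v ∈ S
    · exact hmem v hv w hvw
    by_cases hw : w ∈ S
    · rw [← C.bend_swap hvw]; exact hmem w hw v hvw.symm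
    by_cases hv' : v = E.snd
    · subst hv'; exact hb w hvw
    by_cases hw' : w = E.snd
    · subst hw'; rw [← C.bend_swap hvw]; exact hb v hvw.symm
    · exact bend_eq_zero_of_eq (by rw [hDS' v hv hv', hDS' w hw hw'])
  · by_cases hiS : C.mark i ∈ S
    · exact funext fun j => hD (Sum.inr (Sum.inl
        (⟨i, Finset.mem_filter.mpr ⟨C.mem_marksIn.mpr hiS, hi⟩⟩, j)))
    · exact hDS' _ hiS (hmark i)
  · by_cases hiS : C.mark i ∈ S
    · exact hD (Sum.inr (Sum.inr (Sum.inl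
        ⟨i, Finset.mem_filter.mpr ⟨C.mem_marksIn.mpr hiS, hi⟩⟩)))
    · rw [hDS' _ hiS (hmark i)]; simp

theorem eq_fst_of_forall_not_adj (h : ∀ w ∈ E.side, ¬ C.graph.Adj E.fst w) :
    ∀ v ∈ E.side, v = E.fst := by
  classical
  intro v hv
  have h1 := C.eq_of_closed (A := {E.fst}) E.isTree_sideFinset
    (Finset.singleton_subset_iff.mpr (E.mem_sideFinset.mpr E.fst_mem))
    (Finset.singleton_nonempty _) (fun x hx w hw hxw => by
      rw [Finset.mem_singleton.mp hx] at hxw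
      exact absurd hxw (h w (E.mem_sideFinset.mp hw)))
  rw [← E.mem_sideFinset, ← h1, Finset.mem_singleton] at hv
  exact hv

/-- If a marking is adjacent to an end of the only contracted edge, then there are no other vertices
on this side. -/
theorem eq_fst_of_mark_eq (hC : C.IsTrivalent) (hE : E.IsUnique) {i : I}
    (hi : C.mark i = E.fst) : ∀ v ∈ E.side, v = E.fst := by
  classical
  refine eq_fst_of_forall_not_adj fun w hw hadj => ?_
  have hcard := card_filter_valence hC E.fst
  have hsum := sum_filter_balanced E.fst
  have hne : w ≠ E.snd := fun h => E.snd_notMem (h ▸ hw)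
  have hsub : ({E.snd, w} : Finset C.V) ⊆ Finset.univ.filter fun w => C.graph.Adj E.fst w := by
    intro x hx
    simp only [Finset.mem_insert, Finset.mem_singleton] at hx
    rcases hx with rfl | rfl <;> simp [E.adj, hadj]
  have hm : 0 < (Finset.univ.filter fun i => C.mark i = E.fst).card :=
    Finset.card_pos.mpr ⟨i, by simpa using hi⟩
  have hc2 : ({E.snd, w} : Finset C.V).card = 2 := Finset.card_pair hne.symm
  have hle := Finset.card_le_card hsub
  have heq := Finset.eq_of_subset_of_card_le hsub (by omega)
  -- The edge `E`, the edge to `w` and the marking exhaust the flags at `E.fst`. Balancing makes the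
  -- edge to `w` contracted, against uniqueness of `E`.
  have hends0 : (Finset.univ.filter fun u => C.endAt u = E.fst) = ∅ := by
    rw [← Finset.card_eq_zero]; omega
  rw [hends0, ← heq, Finset.sum_empty, add_zero, Finset.sum_pair hne.symm, E.dir_eq_zero,
    zero_add] at hsum
  have := hE _ _ hadj hsum
  rw [Sym2.congr_right] at this
  exact hne this

/-- If there are no unmarked unbounded edges on one side of the only contracted edge, then there is
only one vertex on this side. -/
theorem eq_fst_of_endsIn_eq_empty (hE : E.IsUnique) (h : C.endsIn E.sideFinset = ∅) :
    ∀ v ∈ E.side, v = E.fst := by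
  refine eq_fst_of_forall_not_adj fun w hw hadj => ?_
  have h1 : C.dir E.fst w = 0 := by
    funext j
    refine C.dir_apply_eq_zero (S := E.sideFinset) (fun p hp => ?_) (fun u hu => ?_)
      (E.mem_sideFinset.mpr E.fst_mem) (E.mem_sideFinset.mpr hw) hadj
    · rw [boundary_sideFinset, Finset.mem_singleton] at hp
      rw [hp, E.dir_eq_zero]
      rfl
    · rw [h] at hu
      exact absurd hu (Finset.notMem_empty u)
  have h2 := hE _ _ hadj h1
  rw [Sym2.congr_right] at h2
  exact E.snd_notMem (h2 ▸ hw)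

-- The contracted edge contributes nothing to the balancing of its side, so the three standard
-- directions occur equally often among the ends there.
open Classical in
theorem degree_component (hends : ∀ u, IsStandardDir (C.endDir u)) :
    ∃ m : ℕ, E.component.degree = standardDegree m ∧ (C.endsIn E.sideFinset).card = 3 * m := by
  obtain ⟨p, q, s, h1, h2, h3, h4⟩ := C.exists_map_endsIn hends E.sideFinset
  have h5 := C.sum_boundary_apply E.sideFinset 0
  have h6 := C.sum_boundary_apply E.sideFinset 1
  rw [boundary_sideFinset, Finset.sum_singleton, E.dir_eq_zero, Pi.zero_apply] at h5 h6
  obtain rfl : p = s := by omega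
  obtain rfl : q = p := by omega
  refine ⟨q, ?_, by omega⟩
  rw [standardDegree, ← h1]
  have h7 : C.endsIn E.sideFinset
      = (Finset.univ : Finset {u // C.endAt u ∈ E.side}).map (Function.Embedding.subtype _) := by
    ext u
    simp [C.mem_endsIn, mem_sideFinset]
  rw [h7, Finset.map_val, Multiset.map_map]
  unfold degree
  congr!

end ContractedEdge

end PlaneTropicalCurve

/-! ### Curves of nonzero multiplicity with a contracted bounded edge -/

namespace Domain

open PlaneTropicalCurve

variable {d n l : ℕ} {hn : 4 ≤ n} {a : ℕ × ℕ → ℝ} (C : Domain d n hn l a)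

theorem isStandardDir (u : C.U) : IsStandardDir (C.endDir u) := by
  have h : C.endDir u ∈ C.degree := Multiset.mem_map_of_mem _ (Finset.mem_univ u)
  rw [C.degree_eq, standardDegree] at h
  simp only [Multiset.mem_add, Multiset.mem_replicate] at h
  rcases h with (h | h) | h
  · exact Or.inl h.2
  · exact Or.inr (Or.inl h.2)
  · exact Or.inr (Or.inr h.2)

theorem card_ends : Fintype.card C.U = 3 * d := by
  have h := congrArg Multiset.card C.degree_eq
  simp only [PlaneTropicalCurve.degree, standardDegree, Multiset.card_map, Multiset.card_add,
    Multiset.card_replicate] at h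
  rw [Fintype.card, Finset.card_def, h]
  ring

/-- The edge `e` separates `x₁`, `x₂` from `x₃`, `x₄`. -/
def Sep (e : Sym2 C.V) : Prop :=
  C.Separates e (firstFour hn 0) (firstFour hn 1) (firstFour hn 2) (firstFour hn 3)

variable {C}

theorem separatingLength_eq {t : ℝ} {ht : 0 < t} (h : C.piTilde.2 = M4.A t ht) :
    C.separatingLength (firstFour hn 0) (firstFour hn 1) (firstFour hn 2) (firstFour hn 3) = t := by
  simp only [piTilde, PlaneTropicalCurve.forget] at h
  split_ifs at h with h1
  exact M4.A.inj h

theorem exists_sep {t : ℝ} {ht : 0 < t} (h : C.piTilde.2 = M4.A t ht) :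
    ∃ e ∈ C.graph.edgeSet, C.Sep e := by
  classical
  by_contra hne
  push Not at hne
  have h1 := separatingLength_eq h
  rw [separatingLength, Finset.sum_eq_zero] at h1
  · exact ht.ne h1
  · exact fun e _ => if_neg (hne e.1 e.2)

-- By the four-point condition, one edge of this type excludes edges of the two other types.
open Classical in
theorem forgetCoeff_eq (h : ∃ e ∈ C.graph.edgeSet, C.Sep e) (e : C.graph.edgeSet) :
    C.forgetCoeff (Sum.inr e) = if C.Sep e.1 then 1 else 0 := by
  obtain ⟨f, -, hf⟩ := h
  have h1 := C.not_separates (f := e.1) hf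
  have h2 := C.not_separates (f := e.1) (Separates.swap C.toPlaneTropicalCurve hf)
  simp only [forgetCoeff, h1, h2, or_false, Sep]
  congr

open Classical in
/-- If the multiplicity is nonzero, then `π̃` is injective on infinitesimal deformations. -/
theorem eq_zero_of_sep (hm : C.mult ≠ 0) (hsep : ∃ e ∈ C.graph.edgeSet, C.Sep e)
    {D : C.V → Fin 2 → ℝ} {ℓ : Sym2 C.V → ℝ}
    (hD : ∀ v w, C.graph.Adj v w → ∀ j, D w j - D v j = ℓ s(v, w) * (C.dir v w j : ℝ))
    (hdef : C.IsDeformation IsPointMarking C.normal D)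
    (hδ : ∑ e : C.graph.edgeSet, (if C.Sep e.1 then ℓ e.1 else 0) = 0) :
    D = 0 ∧ ∀ e ∈ C.graph.edgeSet, ℓ e = 0 := by
  refine C.eq_zero_of_mult_ne_zero hm hD hdef.fixed hdef.normal ?_
  rw [← hδ]
  refine Finset.sum_congr rfl fun e _ => ?_
  rw [forgetCoeff_eq hsep]
  split_ifs <;> simp

theorem isDeformation_zero : C.IsDeformation IsPointMarking C.normal 0 :=
  ⟨fun _ _ _ => map_zero _, fun _ _ => rfl, fun _ _ => by simp⟩

theorem contractedEdge_mem (E : C.ContractedEdge) : s(E.fst, E.snd) ∈ C.graph.edgeSet := E.adj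

open Classical in
theorem sum_single (E : C.ContractedEdge) (hE : C.Sep s(E.fst, E.snd)) (c : ℝ) :
    ∑ e : C.graph.edgeSet,
      (if C.Sep e.1 then (if e.1 = s(E.fst, E.snd) then c else 0) else 0) = c := by
  rw [Finset.sum_eq_single (⟨_, contractedEdge_mem E⟩ : C.graph.edgeSet)]
  · rw [if_pos hE, if_pos rfl]
  · intro e _ hne
    rw [if_neg fun h => hne (Subtype.ext h), ite_self]
  · exact fun h => absurd (Finset.mem_univ _) h

open Classical in
theorem single_mul_dir (E : C.ContractedEdge) (c : ℝ) (v w : C.V) (j : Fin 2) :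
    (if s(v, w) = s(E.fst, E.snd) then c else 0) * (C.dir v w j : ℝ) = 0 := by
  split_ifs with h
  · rcases Sym2.eq_iff.mp h with ⟨rfl, rfl⟩ | ⟨rfl, rfl⟩
    · rw [E.dir_eq_zero]; simp
    · rw [C.dir_swap E.adj, E.dir_eq_zero]; simp
  · rw [zero_mul]

/-- A contracted bounded edge separates `x₁`, `x₂` from `x₃`, `x₄`. -/
theorem sep_of_contractedEdge (hm : C.mult ≠ 0) (hsep : ∃ e ∈ C.graph.edgeSet, C.Sep e)
    (E : C.ContractedEdge) : C.Sep s(E.fst, E.snd) := by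
  classical
  by_contra hE
  -- Lengthening a contracted edge that does not separate the pairs changes neither the images of
  -- the markings nor the length in `M4`.
  have h := eq_zero_of_sep hm hsep (D := 0)
    (ℓ := fun e => if e = s(E.fst, E.snd) then 1 else 0) (fun v w _ j => by
      rw [single_mul_dir E]; simp) isDeformation_zero (Finset.sum_eq_zero fun e _ => by
        split_ifs with h1 h2
        · exact absurd (h2 ▸ h1) hE
        · rfl
        · rfl)
  simpa using h.2 _ (contractedEdge_mem E)

/-- Two contracted edges both separate the pairs. Lengthening one and shortening the other by the
same amount would be a nonzero kernel vector. -/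
theorem contractedEdge_unique (hm : C.mult ≠ 0) (hsep : ∃ e ∈ C.graph.edgeSet, C.Sep e)
    (E E' : C.ContractedEdge) : s(E'.fst, E'.snd) = s(E.fst, E.snd) := by
  classical
  by_contra hne
  have h := eq_zero_of_sep hm hsep (D := 0)
    (ℓ := fun e => (if e = s(E.fst, E.snd) then 1 else 0)
      + (if e = s(E'.fst, E'.snd) then -1 else 0)) (fun v w _ j => by
      rw [add_mul, single_mul_dir E, single_mul_dir E']; simp) isDeformation_zero (by
      have h1 := sum_single E (sep_of_contractedEdge hm hsep E) 1
      have h2 := sum_single E' (sep_of_contractedEdge hm hsep E') (-1)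
      have h3 : ∀ (p : Prop) [Decidable p] (x y : ℝ), (if p then x + y else 0)
          = (if p then x else 0) + (if p then y else 0) := by
        intro p _ x y
        split_ifs <;> simp
      simp only [h3]
      rw [Finset.sum_add_distrib, h1, h2]
      norm_num)
  have h1 := h.2 _ (contractedEdge_mem E)
  simp [Ne.symm hne] at h1

theorem isUnique (hm : C.mult ≠ 0) (hsep : ∃ e ∈ C.graph.edgeSet, C.Sep e)
    (E : C.ContractedEdge) : E.IsUnique :=
  fun v w hvw h0 => contractedEdge_unique hm hsep E ⟨v, w, hvw, h0⟩

/-- The length of `E` moves no vertex but counts in the separating length. Its change can be chosen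
to compensate that of the other edges, so no condition on the length in `M4` is needed. -/
theorem eq_zero_of_isDeformation (hm : C.mult ≠ 0) (hsep : ∃ e ∈ C.graph.edgeSet, C.Sep e)
    (E : C.ContractedEdge) {D : C.V → Fin 2 → ℝ}
    (hdef : C.IsDeformation IsPointMarking C.normal D) (hD : D E.fst = D E.snd) : D = 0 := by
  classical
  have hE := isUnique hm hsep E
  obtain ⟨ℓ, hℓ⟩ := exists_len hdef.bend_eq_zero fun v w hvw h0 => by
    rcases Sym2.eq_iff.mp (hE v w hvw h0) with ⟨rfl, rfl⟩ | ⟨rfl, rfl⟩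
    · exact hD
    · exact hD.symm
  set x := ∑ e : C.graph.edgeSet, (if C.Sep e.1 then ℓ e.1 else 0)
  refine (eq_zero_of_sep hm hsep
    (ℓ := fun e => ℓ e + (if e = s(E.fst, E.snd) then -x else 0)) (fun v w hvw j => by
      rw [add_mul, single_mul_dir E, add_zero, hℓ v w hvw]) hdef ?_).1
  have h2 := sum_single E (sep_of_contractedEdge hm hsep E) (-x)
  have h3 : ∀ (p : Prop) [Decidable p] (x y : ℝ), (if p then x + y else 0)
      = (if p then x else 0) + (if p then y else 0) := by
    intro p _ x y
    split_ifs <;> simp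
  simp only [h3]
  rw [Finset.sum_add_distrib, h2]
  exact add_neg_cancel x

end Domain

namespace Domain

open PlaneTropicalCurve

variable {d l : ℕ} {hn : 4 ≤ 3 * d} {a : ℕ × ℕ → ℝ} {C : Domain d (3 * d) hn l a}

open Classical in
theorem card_marksIn_of_side (E : C.ContractedEdge)
    (h0 : C.mark (firstFour hn 0) ∈ E.side) (h1 : C.mark (firstFour hn 1) ∈ E.side) :
    ((C.marksIn E.sideFinset).filter fun i => ¬ IsPointMarking i).card = 2 := by
  rw [Finset.card_eq_two]
  refine ⟨firstFour hn 0, firstFour hn 1, by simp [Fin.ext_iff], ?_⟩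
  ext i
  simp only [Finset.mem_filter, C.mem_marksIn, E.mem_sideFinset, IsPointMarking, not_le,
    Finset.mem_insert, Finset.mem_singleton]
  constructor
  · rintro ⟨-, h⟩
    rcases (show (i : ℕ) = 0 ∨ (i : ℕ) = 1 by omega) with h | h
    · exact Or.inl (Fin.ext h)
    · exact Or.inr (Fin.ext h)
  · rintro (rfl | rfl)
    · exact ⟨h0, by simp⟩
    · exact ⟨h1, by simp⟩

/-- A curve with a contracted bounded edge, oriented such that `x₁` is on the first component. -/
theorem decomposesUniquely_of_mem (hC : C.IsTrivalent) (hm : C.mult ≠ 0)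
    (hsep : ∃ e ∈ C.graph.edgeSet, C.Sep e) (hadj : ¬ C.FirstTwoAdjacent) (E : C.ContractedEdge)
    (h0 : C.mark (firstFour hn 0) ∈ E.side) : C.DecomposesUniquely := by
  classical
  have hE := isUnique hm hsep E
  obtain ⟨hs1, hs2, hs3⟩ := sep_of_contractedEdge hm hsep E
  have h0' : (C.graph.deleteEdges {s(E.fst, E.snd)}).Reachable E.fst _ := h0
  have h1 : C.mark (firstFour hn 1) ∈ E.side := h0'.trans hs1
  have h2 : C.mark (firstFour hn 2) ∈ E.symm.side :=
    E.mem_symm_side.mpr fun h => hs3 (h0'.symm.trans h)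
  have h3 : C.mark (firstFour hn 3) ∈ E.symm.side :=
    E.mem_symm_side.mpr fun h => hs3 (h0'.symm.trans (SimpleGraph.Reachable.trans h hs2.symm))
  -- Neither side is a single vertex: on one side this would make `x₁`, `x₂` adjacent, on the other
  -- `x₃`, `x₄`, which nonzero multiplicity forbids.
  have hdeg1 : ¬ ∀ v ∈ E.side, v = E.fst := fun h => hadj ((h _ h0).trans (h _ h1).symm)
  have hdeg2 : ¬ ∀ v ∈ E.symm.side, v = E.symm.fst := fun h => by
    have := C.mark_injective_of_mult_ne_zero hm (i := firstFour hn 2) (i' := firstFour hn 3)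
      (by simp [IsPointMarking]) (by simp [IsPointMarking]) ((h _ h2).trans (h _ h3).symm)
    simp [Fin.ext_iff] at this
  obtain ⟨d₁, hd1, hc1⟩ := E.degree_component C.isStandardDir
  obtain ⟨d₂, hd2, hc2⟩ := E.symm.degree_component C.isStandardDir
  have hpos1 : 0 < d₁ := by
    by_contra h
    exact hdeg1 (ContractedEdge.eq_fst_of_endsIn_eq_empty hE (Finset.card_eq_zero.mp (by omega)))
  have hpos2 : 0 < d₂ := by
    by_contra h
    exact hdeg2 (ContractedEdge.eq_fst_of_endsIn_eq_empty hE.symm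
      (Finset.card_eq_zero.mp (by omega)))
  have hb1 := C.card_add_two hC E.isTree_sideFinset
  have hb2 := C.card_add_two hC E.symm.isTree_sideFinset
  rw [ContractedEdge.boundary_sideFinset, Finset.card_singleton] at hb1 hb2
  have hle1 := E.card_sideFinset_le hC hE
    (fun D hD h => eq_zero_of_isDeformation hm hsep E hD h)
    (fun i hi => hdeg2 (ContractedEdge.eq_fst_of_mark_eq hC hE.symm hi))
  have hle2 := E.symm.card_sideFinset_le hC hE.symm
    (fun D hD h => eq_zero_of_isDeformation hm hsep E hD h.symm)
    (fun i hi => hdeg1 (ContractedEdge.eq_fst_of_mark_eq hC hE hi))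
  have hn1 := card_marksIn_of_side E h0 h1
  have hn2 : (C.marksIn E.symm.sideFinset).filter (fun i => ¬ IsPointMarking i) = ∅ := by
    refine Finset.eq_empty_of_forall_notMem fun i hi => ?_
    rw [Finset.mem_filter, C.mem_marksIn, E.symm.mem_sideFinset, E.mem_symm_side] at hi
    obtain ⟨h, h'⟩ := hi
    rw [IsPointMarking, not_le] at h'
    rcases (show (i : ℕ) = 0 ∨ (i : ℕ) = 1 by omega) with h' | h'
    · exact h ((show i = firstFour hn 0 from Fin.ext h') ▸ h0)
    · exact h ((show i = firstFour hn 1 from Fin.ext h') ▸ h1)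
  rw [hn1] at hle1
  rw [hn2, Finset.card_empty] at hle2
  have hf1 := Finset.card_filter_add_card_filter_not (s := C.marksIn E.sideFinset) IsPointMarking
  have hf2 := Finset.card_filter_add_card_filter_not (s := C.marksIn E.symm.sideFinset)
    IsPointMarking
  rw [hn1] at hf1
  rw [hn2, Finset.card_empty] at hf2
  have hmarks : (C.marksIn E.sideFinset).card + (C.marksIn E.symm.sideFinset).card = 3 * d := by
    have := Finset.card_filter_add_card_filter_not (s := (Finset.univ : Finset (Fin (3 * d))))
      (fun i => C.mark i ∈ E.sideFinset)
    rw [Finset.card_univ, Fintype.card_fin] at this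
    simpa only [marksIn, E.sideFinset_symm, Finset.mem_compl] using this
  have hends : (C.endsIn E.sideFinset).card + (C.endsIn E.symm.sideFinset).card = 3 * d := by
    have := Finset.card_filter_add_card_filter_not (s := (Finset.univ : Finset C.U))
      (fun u => C.endAt u ∈ E.sideFinset)
    rw [Finset.card_univ, C.card_ends] at this
    simpa only [endsIn, E.sideFinset_symm, Finset.mem_compl] using this
  -- With `m₁`, `m₂` markings of `C` on the sides, `hb1` and `hle1` give `3 * d₁ + 1 ≤ m₁`, and
  -- `hb2` and `hle2` give `3 * d₂ - 1 ≤ m₂`. As `m₁ + m₂ = 3 * d₁ + 3 * d₂`, both are equalities;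
  -- without `x₁`, `x₂` there remain `3 * d₁ - 1` markings on the first side.
  refine ⟨E, contractedEdge_unique hm hsep E, d₁, d₂, hpos1, hpos2, by omega, hd1, hd2, h0, h1,
    h2, h3, ?_⟩
  have hset : {i : Fin (3 * d) | 4 ≤ (i : ℕ) ∧ C.mark i ∈ E.side}
      = ((C.marksIn E.sideFinset).filter IsPointMarking : Finset _) := by
    ext i
    simp only [Set.mem_ofPred_eq, Finset.coe_filter, C.mem_marksIn, E.mem_sideFinset,
      IsPointMarking]
    constructor
    · exact fun h => ⟨h.2, by omega⟩
    · rintro ⟨h, h'⟩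
      refine ⟨?_, h⟩
      by_contra h4
      rcases (show (i : ℕ) = 2 ∨ (i : ℕ) = 3 by omega) with h' | h'
      · exact E.mem_symm_side.mp h2 ((show i = firstFour hn 2 from Fin.ext h') ▸ h)
      · exact E.mem_symm_side.mp h3 ((show i = firstFour hn 3 from Fin.ext h') ▸ h)
  rw [hset, Set.ncard_coe_finset]
  omega

theorem decomposesUniquely (hC : C.IsTrivalent) (hm : C.mult ≠ 0)
    (hsep : ∃ e ∈ C.graph.edgeSet, C.Sep e) (hadj : ¬ C.FirstTwoAdjacent) (E : C.ContractedEdge) :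
    C.DecomposesUniquely := by
  by_cases h0 : C.mark (firstFour hn 0) ∈ E.side
  · exact decomposesUniquely_of_mem hC hm hsep hadj E h0
  · exact decomposesUniquely_of_mem hC hm hsep hadj E.symm (E.mem_symm_side.mpr h0)

end Domain

/-! ### The directions in which a tropical curve of degree `l` is unbounded -/

/-- The linear form given by `x` attains its maximum over the triangle of exponents at two or more
lattice points. In the interior of a maximal cone of the normal fan only a corner is maximal; `k0`,
`k1`, `k2` exclude the three interiors. What remains are the three rays of the fan. -/
theorem exists_standardDir {l : ℕ} {x : Fin 2 → ℝ} {M : Finset (ℕ × ℕ)} (hM : M ⊆ exponents l)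
    (hcard : 2 ≤ M.card) (hmax : ∀ m ∈ M, ∀ m' ∈ exponents l,
      (m'.1 : ℝ) * x 0 + m'.2 * x 1 ≤ m.1 * x 0 + m.2 * x 1) :
    ∃ s : ℝ, 0 ≤ s ∧ ∃ e, IsStandardDir e ∧ x = fun j => s * (e j : ℝ) := by
  have hmem : ∀ i j : ℕ, (i, j) ∈ exponents l ↔ i + j ≤ l := by
    intro i j
    simp only [exponents, Finset.mem_filter, Finset.mem_product, Finset.mem_range]
    omega
  have hM' : ∀ m ∈ M, m.1 + m.2 ≤ l := fun m hm => (hmem _ _).mp (hM hm)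
  have h0 : ∀ m ∈ M, 0 ≤ (m.1 : ℝ) * x 0 + m.2 * x 1 := fun m hm => by
    simpa using hmax m hm (0, 0) ((hmem _ _).mpr (by omega))
  have h1 : ∀ m ∈ M, (l : ℝ) * x 0 ≤ m.1 * x 0 + m.2 * x 1 := fun m hm => by
    simpa using hmax m hm (l, 0) ((hmem _ _).mpr (by omega))
  have h2 : ∀ m ∈ M, (l : ℝ) * x 1 ≤ m.1 * x 0 + m.2 * x 1 := fun m hm => by
    simpa using hmax m hm (0, l) ((hmem _ _).mpr (by omega))
  have huniq : ∀ p : ℕ × ℕ, ¬ ∀ m ∈ M, m = p := fun p hp => by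
    have := Finset.card_le_card (fun m hm => Finset.mem_singleton.mpr (hp m hm) : M ⊆ {p})
    rw [Finset.card_singleton] at this
    omega
  have hl : ∀ m ∈ M, (m.1 : ℝ) + m.2 ≤ l := fun m hm => by exact_mod_cast hM' m hm
  have k0 : 0 ≤ x 0 ∨ 0 ≤ x 1 := by
    by_contra hlt
    push Not at hlt
    refine huniq (0, 0) fun m hm => ?_
    have h3 := h0 m hm
    by_contra hne
    have h4 : 0 < m.1 ∨ 0 < m.2 := by
      by_contra h5
      exact hne (Prod.ext (by simp; omega) (by simp; omega))
    rcases h4 with h4 | h4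
    · have h5 : (0 : ℝ) < m.1 := by exact_mod_cast h4
      nlinarith [mul_pos_of_neg_of_neg hlt.1 (neg_lt_zero.mpr h5),
        mul_nonneg (Nat.cast_nonneg (α := ℝ) m.2) (neg_pos.mpr hlt.2).le]
    · have h5 : (0 : ℝ) < m.2 := by exact_mod_cast h4
      nlinarith [mul_pos_of_neg_of_neg hlt.2 (neg_lt_zero.mpr h5),
        mul_nonneg (Nat.cast_nonneg (α := ℝ) m.1) (neg_pos.mpr hlt.1).le]
  have k1 : x 0 ≤ 0 ∨ x 0 ≤ x 1 := by
    by_contra hlt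
    push Not at hlt
    refine huniq (l, 0) fun m hm => ?_
    have h3 := h1 m hm
    have h6 := hl m hm
    have h7 : (m.2 : ℝ) * x 1 ≤ m.2 * x 0 :=
      mul_le_mul_of_nonneg_left hlt.2.le (Nat.cast_nonneg _)
    have h8 : (l : ℝ) * x 0 ≤ ((m.1 : ℝ) + m.2) * x 0 := by linarith
    have h9 : l ≤ m.1 + m.2 := by exact_mod_cast le_of_mul_le_mul_right h8 hlt.1
    have h10 : m.2 = 0 := by
      by_contra hne
      have h11 : (0 : ℝ) < m.2 := by exact_mod_cast Nat.pos_of_ne_zero hne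
      have h12 := mul_lt_mul_of_pos_left hlt.2 h11
      have h13 := mul_le_mul_of_nonneg_right h6 hlt.1.le
      linarith
    have := hM' m hm
    exact Prod.ext (by simp; omega) h10
  have k2 : x 1 ≤ 0 ∨ x 1 ≤ x 0 := by
    by_contra hlt
    push Not at hlt
    refine huniq (0, l) fun m hm => ?_
    have h3 := h2 m hm
    have h6 := hl m hm
    have h7 : (m.1 : ℝ) * x 0 ≤ m.1 * x 1 :=
      mul_le_mul_of_nonneg_left hlt.2.le (Nat.cast_nonneg _)
    have h8 : (l : ℝ) * x 1 ≤ ((m.1 : ℝ) + m.2) * x 1 := by linarith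
    have h9 : l ≤ m.1 + m.2 := by exact_mod_cast le_of_mul_le_mul_right h8 hlt.1
    have h10 : m.1 = 0 := by
      by_contra hne
      have h11 : (0 : ℝ) < m.1 := by exact_mod_cast Nat.pos_of_ne_zero hne
      have h12 := mul_lt_mul_of_pos_left hlt.2 h11
      have h13 := mul_le_mul_of_nonneg_right h6 hlt.1.le
      linarith
    have := hM' m hm
    exact Prod.ext h10 (by simp; omega)
  have hext : ∀ y : Fin 2 → ℝ, x 0 = y 0 → x 1 = y 1 → x = y := fun y e0 e1 =>
    funext fun j => by fin_cases j <;> assumption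
  by_cases hx : x 0 ≤ 0
  · by_cases hy : x 1 ≤ 0
    · rcases k0 with h | h
      · exact ⟨-x 1, by linarith, _, Or.inr (Or.inl rfl), hext _ (by simp; linarith) (by simp)⟩
      · exact ⟨-x 0, by linarith, _, Or.inl rfl, hext _ (by simp) (by simp; linarith)⟩
    · have h3 := k2.resolve_left hy
      linarith
  · have h3 := k1.resolve_left hx
    have h4 : x 1 ≤ x 0 := k2.resolve_left (by linarith)
    exact ⟨x 0, by linarith, _, Or.inr (Or.inr rfl), hext _ (by simp) (by simp; linarith)⟩

theorem mem_maximizers {l : ℕ} {a : ℕ × ℕ → ℝ} {q : Fin 2 → ℝ} {m : ℕ × ℕ} :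
    m ∈ maximizers l a q ↔ m ∈ exponents l ∧
      ∀ m' ∈ exponents l, monomialValue a q m' ≤ monomialValue a q m := by
  simp [maximizers]

/-- The displacement between points on the same edge is orthogonal to the normal vector. -/
theorem edgeNormal_mul_sub {l : ℕ} {a : ℕ × ℕ → ℝ} {q q' : Fin 2 → ℝ}
    (h : maximizers l a q = maximizers l a q') :
    (edgeNormal l a q 0 : ℝ) * (q' 0 - q 0) + (edgeNormal l a q 1 : ℝ) * (q' 1 - q 1) = 0 := by
  obtain ⟨m, hm, m', hm', heq⟩ := (exists_longest l a q).choose_spec.1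
  have hν : edgeNormal l a q = exponentDiff m m' := heq
  have hq := hm
  have hq' := hm'
  rw [h] at hq hq'
  rw [mem_maximizers] at hm hm' hq hq'
  have h1 := le_antisymm (hm.2 m' hm'.1) (hm'.2 m hm.1)
  have h2 := le_antisymm (hq.2 m' hq'.1) (hq'.2 m hq.1)
  simp only [monomialValue] at h1 h2
  simp only [hν, exponentDiff, Matrix.cons_val_zero, Matrix.cons_val_one, Int.cast_sub,
    Int.cast_natCast]
  linear_combination h1 - h2

/-! ### Curves without contracted bounded edges -/

namespace Domain

open PlaneTropicalCurve

variable {d n l : ℕ} {hn : 4 ≤ n} {a : ℕ × ℕ → ℝ} {C : Domain d n hn l a}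

open Classical in
/-- A curve without contracted bounded edges does not have a deformation which does not shorten any
edge, moves `x₁` and `x₂` in the directions of unbounded edges, and lengthens the edges between
`x₁`, `x₂` and `x₃`, `x₄`. -/
theorem sum_sep_eq_zero (hC : C.IsTrivalent) (hm : C.mult ≠ 0)
    (hsep : ∃ e ∈ C.graph.edgeSet, C.Sep e) (hadj : ¬ C.FirstTwoAdjacent)
    (hdir : ∀ v w, C.graph.Adj v w → C.dir v w ≠ 0) {D : C.V → Fin 2 → ℝ} {ℓ : Sym2 C.V → ℝ}
    (hℓ : ∀ v w, C.graph.Adj v w → 0 ≤ ℓ s(v, w))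
    (hD : ∀ v w, C.graph.Adj v w → ∀ j, D w j - D v j = ℓ s(v, w) * (C.dir v w j : ℝ))
    (hdef : C.IsDeformation IsPointMarking C.normal D)
    (hcone : ∀ i, ¬ IsPointMarking i → ∃ s : ℝ, 0 ≤ s ∧ ∃ e, IsStandardDir e ∧
      D (C.mark i) = fun j => s * (e j : ℝ)) :
    ∑ e : C.graph.edgeSet, (if C.Sep e.1 then ℓ e.1 else 0) = 0 := by
  by_contra hδ
  -- Without contracted edges every deformation comes from a change of lengths. Subtracting the
  -- multiple of `D` with the same change of the separating length leaves a kernel vector.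
  have huniq : ∀ D', C.IsDeformation IsPointMarking C.normal D' → ∃ c : ℝ, D' = c • D := by
    intro D' hD'
    obtain ⟨ℓ', hℓ'⟩ := exists_len hD'.bend_eq_zero fun v w hvw h0 => absurd h0 (hdir v w hvw)
    set x := ∑ e : C.graph.edgeSet, (if C.Sep e.1 then ℓ e.1 else 0) with hx
    set x' := ∑ e : C.graph.edgeSet, (if C.Sep e.1 then ℓ' e.1 else 0) with hx'
    refine ⟨x' / x, sub_eq_zero.mp ?_⟩
    refine (eq_zero_of_sep hm hsep (ℓ := fun e => ℓ' e - x' / x * ℓ e) (fun v w hvw j => ?_)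
      ⟨fun v w hvw => ?_, fun i hi => ?_, fun i hi => ?_⟩ ?_).1
    · have h1 := hℓ' v w hvw j
      have h2 := hD v w hvw j
      simp only [Pi.sub_apply, Pi.smul_apply, smul_eq_mul]
      linear_combination h1 - x' / x * h2
    · rw [map_sub, map_smul, hD'.bend_eq_zero v w hvw, hdef.bend_eq_zero v w hvw]
      simp
    · rw [Pi.sub_apply, Pi.smul_apply, hD'.fixed i hi, hdef.fixed i hi]
      simp
    · have h1 := hD'.normal i hi
      have h2 := hdef.normal i hi
      simp only [Pi.sub_apply, Pi.smul_apply, smul_eq_mul]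
      linear_combination h1 - x' / x * h2
    · have h3 : ∀ e : C.graph.edgeSet, (if C.Sep e.1 then ℓ' e.1 - x' / x * ℓ e.1 else 0)
          = (if C.Sep e.1 then ℓ' e.1 else 0) - x' / x * (if C.Sep e.1 then ℓ e.1 else 0) := by
        intro e
        split_ifs <;> simp
      rw [Finset.sum_congr rfl fun e _ => h3 e, Finset.sum_sub_distrib, ← Finset.mul_sum, ← hx,
        ← hx', div_mul_cancel₀ _ hδ, sub_self]
  obtain ⟨⟨e, he⟩, -, hne⟩ := Finset.exists_ne_zero_of_sum_ne_zero hδ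
  dsimp only at hne
  have hse : C.Sep e := by
    by_contra h
    exact hne (if_neg h)
  rw [if_pos hse] at hne
  have hends : ∀ v w, e = s(v, w) → C.graph.Adj v w → D v ≠ D w := by
    intro v w hvw hadj' heq
    refine hdir v w hadj' (funext fun j => ?_)
    have h1 := hD v w hadj' j
    rw [heq, sub_self, ← hvw] at h1
    exact_mod_cast (mul_eq_zero.mp h1.symm).resolve_left hne
  have hD0 : D ≠ 0 := by
    rintro rfl
    induction e with
    | h v w => exact hends v w rfl he rfl
  obtain ⟨v, hv, hleaf⟩ := exists_leaf hC C.isStandardDir hℓ hD hdef huniq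
    ⟨firstFour hn 2, by simp [IsPointMarking]⟩ hcone hD0
  have hDv : D v ≠ 0 := fun h => hD0 (funext fun w => by
    by_cases hw : w = v
    · rw [hw, h]; rfl
    · exact hv w hw)
  -- The ends of `e` move differently, so one of them is the only moving vertex `v`.
  obtain ⟨w, hw, rfl⟩ : ∃ w, C.graph.Adj v w ∧ e = s(v, w) := by
    induction e with
    | h x y =>
      by_cases hx : x = v
      · exact ⟨y, hx ▸ he, by rw [hx]⟩
      by_cases hy : y = v
      · exact ⟨x, hy ▸ (show C.graph.Adj x y from he).symm, by rw [hy, Sym2.eq_swap]⟩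
      exact absurd ((hv x hx).trans (hv y hy).symm) (hends x y rfl he)
  have hiso : ∀ z, (C.graph.deleteEdges {s(v, w)}).Reachable v z → z = v := by
    intro z hz
    by_contra hne
    obtain ⟨p⟩ := hz
    obtain ⟨b, -, h1, h2⟩ := p.exists_boundary_dart {v} rfl hne
    have h3 := b.adj
    rw [SimpleGraph.deleteEdges_adj, Set.mem_singleton_iff.mp h1] at h3
    exact h3.2 (by rw [hleaf _ _ h3.1 hw]; rfl)
  obtain ⟨s1, s2, s3⟩ := hse
  -- The edge cuts off `v` alone. If `x₁` is on the side of `v`, so is `x₂`, and both are at `v`.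
  -- Otherwise `x₃` is at `v`, and `v` would be fixed.
  rcases C.reachable_or_reachable v w (C.mark (firstFour hn 0)) with h0 | h0
  · exact hadj ((hiso _ h0).trans (hiso _ (h0.trans s1)).symm)
  rcases C.reachable_or_reachable v w (C.mark (firstFour hn 2)) with h2 | h2
  · refine hDv ?_
    rw [← hiso _ h2]
    exact hdef.fixed _ (by simp [IsPointMarking])
  · exact s3 (h0.symm.trans h2)

end Domain

namespace PlaneTropicalCurve

variable {I : Type} [Fintype I] (C : PlaneTropicalCurve I)

/-- The directions of the bounded edges are bounded in terms of the degree. -/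
theorem abs_dir_le (hends : ∀ u, IsStandardDir (C.endDir u)) {v w : C.V} (h : C.graph.Adj v w)
    (j : Fin 2) : |C.dir v w j| ≤ Fintype.card C.U := by
  classical
  -- By balancing one side of the edge, its direction is minus the sum of the ends there, whose
  -- coordinates are at most 1 in absolute value.
  set A := Finset.univ.filter fun x => (C.graph.deleteEdges {s(v, w)}).Reachable v x with hA
  have h1 : C.boundary A = {(v, w)} := by
    ext ⟨x, y⟩
    simp only [C.mem_boundary, hA, Finset.mem_filter, Finset.mem_univ, true_and,
      Finset.mem_singleton, Prod.mk.injEq]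
    constructor
    · rintro ⟨hx, hy, hxy⟩
      exact C.eq_of_adj_of_reachable h hxy hx hy
    · rintro ⟨rfl, rfl⟩
      exact ⟨SimpleGraph.Reachable.refl _, C.not_reachable_deleteEdges h, h⟩
  have h2 := C.sum_boundary_apply A j
  rw [h1, Finset.sum_singleton] at h2
  have h3 : |∑ u ∈ C.endsIn A, C.endDir u j| ≤ (C.endsIn A).card := by
    refine (Finset.abs_sum_le_sum_abs _ _).trans ?_
    rw [Finset.card_eq_sum_ones, Nat.cast_sum]
    refine Finset.sum_le_sum fun u _ => ?_
    rcases hends u with hu | hu | hu <;> rw [hu] <;> fin_cases j <;> simp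
  have h4 : ((C.endsIn A).card : ℤ) ≤ Fintype.card C.U := by exact_mod_cast Finset.card_le_univ _
  rw [eq_neg_of_add_eq_zero_left h2, abs_neg]
  exact h3.trans h4

theorem bend_eq_zero_of_len {D : C.V → Fin 2 → ℝ} {ℓ : Sym2 C.V → ℝ}
    (hD : ∀ v w, C.graph.Adj v w → ∀ j, D w j - D v j = ℓ s(v, w) * (C.dir v w j : ℝ))
    {v w : C.V} (h : C.graph.Adj v w) : C.bend v w D = 0 := by
  rw [bend_apply, hD v w h, hD v w h]
  ring

end PlaneTropicalCurve

/-! ### Curves of the same combinatorial type -/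

namespace Domain

open PlaneTropicalCurve

variable {d n l : ℕ} {hn : 4 ≤ n} {a : ℕ × ℕ → ℝ} {C C' : Domain d n hn l a}

/-- Two curves have the same combinatorial type, and `x₁`, `x₂` are mapped to the same edges of the
tropical curve of degree `l`. -/
structure SameType (C C' : Domain d n hn l a) where
  equiv : C.V ≃ C'.V
  adj_iff : ∀ v w, C'.graph.Adj (equiv v) (equiv w) ↔ C.graph.Adj v w
  dir_eq : ∀ v w, C.graph.Adj v w → C'.dir (equiv v) (equiv w) = C.dir v w
  mark_eq : ∀ i, C'.mark i = equiv (C.mark i)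
  maximizers_eq : ∀ i, ¬ IsPointMarking i → maximizers l a (C.ev i) = maximizers l a (C'.ev i)

namespace SameType

variable (g : SameType C C')

/-- The isomorphism of the underlying trees without an edge. -/
def deleteIso (e : Sym2 C.V) :
    C.graph.deleteEdges {e} ≃g C'.graph.deleteEdges {e.map g.equiv} where
  toEquiv := g.equiv
  map_rel_iff' := by
    intro v w
    rw [SimpleGraph.deleteEdges_adj, SimpleGraph.deleteEdges_adj, g.adj_iff]
    refine and_congr_right fun _ => not_congr ?_
    rw [Set.mem_singleton_iff, Set.mem_singleton_iff, ← Sym2.map_mk]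
    exact (Sym2.map.injective g.equiv.injective).eq_iff

theorem sep_iff (e : Sym2 C.V) : C'.Sep (e.map g.equiv) ↔ C.Sep e := by
  have h : ∀ i j, (C'.graph.deleteEdges {e.map g.equiv}).Reachable (C'.mark i) (C'.mark j)
      ↔ (C.graph.deleteEdges {e}).Reachable (C.mark i) (C.mark j) := by
    intro i j
    rw [g.mark_eq, g.mark_eq]
    exact (g.deleteIso e).reachable_iff
  simp only [Sep, Separates, h]

theorem mem_edgeSet_iff (e : Sym2 C.V) : e.map g.equiv ∈ C'.graph.edgeSet ↔ e ∈ C.graph.edgeSet := by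
  induction e with
  | h v w => exact g.adj_iff v w

/-- The displacements of the vertices. -/
def displacement (v : C.V) (j : Fin 2) : ℝ := C'.pos (g.equiv v) j - C.pos v j

/-- The changes of the lengths of the bounded edges. -/
def lenChange (e : Sym2 C.V) : ℝ := C'.len (e.map g.equiv) - C.len e

theorem displacement_sub {v w : C.V} (h : C.graph.Adj v w) (j : Fin 2) :
    g.displacement w j - g.displacement v j = g.lenChange s(v, w) * (C.dir v w j : ℝ) := by
  have h1 := C.pos_sub v w h j
  have h2 := C'.pos_sub _ _ ((g.adj_iff v w).mpr h) j
  rw [g.dir_eq v w h] at h2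
  simp only [displacement, lenChange, Sym2.map_mk]
  linear_combination h2 - h1

theorem isDeformation (hev : ∀ i, IsPointMarking i → C'.ev i = C.ev i) :
    C.IsDeformation IsPointMarking C.normal g.displacement := by
  have hpos : ∀ i j, g.displacement (C.mark i) j = C'.ev i j - C.ev i j := by
    intro i j
    rw [displacement, ← g.mark_eq]
    rfl
  refine ⟨fun v w h => C.bend_eq_zero_of_len (fun v w h => g.displacement_sub h) h,
    fun i hi => funext fun j => ?_, fun i hi => ?_⟩
  · rw [hpos, hev i hi, sub_self]; rfl
  · rw [hpos, hpos]
    exact edgeNormal_mul_sub (g.maximizers_eq i hi)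

open Classical in
theorem sum_lenChange {t t' : ℝ} {ht : 0 < t} {ht' : 0 < t'} (h : C.piTilde.2 = M4.A t ht)
    (h' : C'.piTilde.2 = M4.A t' ht') :
    ∑ e : C.graph.edgeSet, (if C.Sep e.1 then g.lenChange e.1 else 0) = t' - t := by
  have h1 := separatingLength_eq h
  have h2 := separatingLength_eq h'
  have h3 : ∑ e : C'.graph.edgeSet, (if C'.Sep e.1 then C'.len e.1 else 0)
      = ∑ e : C.graph.edgeSet, (if C.Sep e.1 then C'.len (e.1.map g.equiv) else 0) := by
    symm
    refine Fintype.sum_bijective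
      (fun e : C.graph.edgeSet =>
        (⟨e.1.map g.equiv, (g.mem_edgeSet_iff _).mpr e.2⟩ : C'.graph.edgeSet))
      ⟨?_, ?_⟩ _ _ fun e => ?_
    · intro e e' he
      exact Subtype.ext (Sym2.map.injective g.equiv.injective (congrArg Subtype.val he))
    · rintro ⟨e, he⟩
      have h4 : (e.map g.equiv.symm).map g.equiv = e := by
        rw [Sym2.map_map]
        simp
      exact ⟨⟨e.map g.equiv.symm, by rw [← g.mem_edgeSet_iff, h4]; exact he⟩, Subtype.ext h4⟩
    · simp only [g.sep_iff]
  rw [← h1, ← h2]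
  have h4 : ∀ e : C.graph.edgeSet, (if C.Sep e.1 then g.lenChange e.1 else 0)
      = (if C.Sep e.1 then C'.len (e.1.map g.equiv) else 0)
        - (if C.Sep e.1 then C.len e.1 else 0) := by
    intro e
    split_ifs
    · rfl
    · simp
  rw [Finset.sum_congr rfl fun e _ => h4 e, Finset.sum_sub_distrib, ← h3]
  rfl

end SameType

theorem ev_mem (i : Fin n) (hi : ¬ IsPointMarking i) : 2 ≤ (maximizers l a (C.ev i)).card := by
  rw [IsPointMarking, not_le] at hi
  rcases (show (i : ℕ) = 0 ∨ (i : ℕ) = 1 by omega) with h | h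
  · rw [show i = firstFour hn 0 from Fin.ext h]; exact C.ev_first
  · rw [show i = firstFour hn 1 from Fin.ext h]; exact C.ev_second

/-- The combinatorial type of a curve without contracted bounded edges does not contain curves with
the same images of `x₃, …, x_n` for which `x₁`, `x₂` are arbitrarily far from `x₃`, `x₄`. -/
theorem exists_bound_of_sameType (hC : C.IsTrivalent) (hm : C.mult ≠ 0)
    (hadj : ¬ C.FirstTwoAdjacent) (hdir : ∀ v w, C.graph.Adj v w → C.dir v w ≠ 0)
    {t : ℝ} {ht : 0 < t} (hpi : C.piTilde.2 = M4.A t ht) :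
    ∃ R : ℝ, ∀ (t' : ℝ) (ht' : 0 < t') (C' : Domain d n hn l a), Nonempty (SameType C C') →
      C'.piTilde = (C.piTilde.1, M4.A t' ht') → t' ≤ R := by
  classical
  by_contra hcon
  push Not at hcon
  have hsep := exists_sep hpi
  have hev : ∀ {t' : ℝ} {ht' : 0 < t'} {C' : Domain d n hn l a},
      C'.piTilde = (C.piTilde.1, M4.A t' ht') → ∀ i, IsPointMarking i → C'.ev i = C.ev i :=
    fun h i hi => congrFun (congrArg Prod.fst h) ⟨i, hi⟩
  obtain ⟨t₁, ht₁, C₁, ⟨g₁⟩, hpi₁, hlt₁⟩ := hcon t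
  have hpos : 0 < t₁ - t := sub_pos.mpr hlt₁
  -- The difference to one further curve of the type, normalized so that the separating length grows
  -- by 1.
  set D : C.V → Fin 2 → ℝ := (t₁ - t)⁻¹ • g₁.displacement with hDdef
  set ℓ : Sym2 C.V → ℝ := fun e => (t₁ - t)⁻¹ * g₁.lenChange e with hℓdef
  have hD : ∀ v w, C.graph.Adj v w → ∀ j, D w j - D v j = ℓ s(v, w) * (C.dir v w j : ℝ) := by
    intro v w h j
    have h1 := g₁.displacement_sub h j
    simp only [hDdef, hℓdef, Pi.smul_apply, smul_eq_mul]
    linear_combination (t₁ - t)⁻¹ * h1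
  have hdef₁ := g₁.isDeformation (hev hpi₁)
  have hdef : C.IsDeformation IsPointMarking C.normal D := by
    refine ⟨fun v w h => C.bend_eq_zero_of_len hD h, fun i hi => ?_, fun i hi => ?_⟩
    · rw [hDdef, Pi.smul_apply, hdef₁.fixed i hi, smul_zero]
    · have h1 := hdef₁.normal i hi
      simp only [hDdef, Pi.smul_apply, smul_eq_mul]
      linear_combination (t₁ - t)⁻¹ * h1
  have hsum : ∑ e : C.graph.edgeSet, (if C.Sep e.1 then ℓ e.1 else 0) = 1 := by
    have h1 := g₁.sum_lenChange hpi (congrArg Prod.snd hpi₁)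
    rw [show (1 : ℝ) = (t₁ - t)⁻¹ * ∑ e : C.graph.edgeSet,
      (if C.Sep e.1 then g₁.lenChange e.1 else 0) by rw [h1, inv_mul_cancel₀ hpos.ne'],
      Finset.mul_sum]
    refine Finset.sum_congr rfl fun e _ => ?_
    split_ifs <;> simp [hℓdef]
  -- By injectivity all curves of this type over the same points lie on one line, with parameter
  -- `t'`.
  have hprop : ∀ {t' : ℝ} {ht' : 0 < t'} {C' : Domain d n hn l a} (g : SameType C C'),
      C'.piTilde = (C.piTilde.1, M4.A t' ht') →
      (∀ v j, g.displacement v j = (t' - t) * D v j) ∧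
        ∀ e ∈ C.graph.edgeSet, g.lenChange e = (t' - t) * ℓ e := by
    intro t' ht' C' g hpi'
    have hdef' := g.isDeformation (hev hpi')
    have h1 := eq_zero_of_sep hm hsep (D := g.displacement - (t' - t) • D)
      (ℓ := fun e => g.lenChange e - (t' - t) * ℓ e) (fun v w h j => by
        have h1 := g.displacement_sub h j
        have h2 := hD v w h j
        simp only [Pi.sub_apply, Pi.smul_apply, smul_eq_mul]
        linear_combination h1 - (t' - t) * h2)
      ⟨fun v w h => by
        rw [map_sub, map_smul, hdef'.bend_eq_zero v w h, hdef.bend_eq_zero v w h]; simp,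
      fun i hi => by
        rw [Pi.sub_apply, Pi.smul_apply, hdef'.fixed i hi, hdef.fixed i hi]; simp,
      fun i hi => by
        have h1 := hdef'.normal i hi
        have h2 := hdef.normal i hi
        simp only [Pi.sub_apply, Pi.smul_apply, smul_eq_mul]
        linear_combination h1 - (t' - t) * h2⟩ (by
        have h3 : ∀ e : C.graph.edgeSet,
            (if C.Sep e.1 then g.lenChange e.1 - (t' - t) * ℓ e.1 else 0)
            = (if C.Sep e.1 then g.lenChange e.1 else 0)
              - (t' - t) * (if C.Sep e.1 then ℓ e.1 else 0) := by
          intro e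
          split_ifs <;> simp
        rw [Finset.sum_congr rfl fun e _ => h3 e, Finset.sum_sub_distrib, ← Finset.mul_sum, hsum,
          g.sum_lenChange hpi (congrArg Prod.snd hpi'), mul_one, sub_self])
    exact ⟨fun v j => sub_eq_zero.mp (congrFun (congrFun h1.1 v) j),
      fun e he => sub_eq_zero.mp (h1.2 e he)⟩
  -- An affine function of `t'` that stays nonpositive for arbitrarily large `t'` has nonpositive
  -- slope.
  have hbound : ∀ A B : ℝ, (∀ (t' : ℝ) (ht' : 0 < t') (C' : Domain d n hn l a),
      SameType C C' → C'.piTilde = (C.piTilde.1, M4.A t' ht') → A + (t' - t) * B ≤ 0) → B ≤ 0 := by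
    intro A B h
    by_contra hB
    obtain ⟨t', ht', C', ⟨g⟩, hpi', hlt⟩ := hcon (t - A / B)
    have h1 := h t' ht' C' g hpi'
    have h2 := mul_lt_mul_of_pos_right hlt (not_le.mp hB)
    rw [sub_mul, div_mul_cancel₀ _ (not_le.mp hB).ne'] at h2
    linarith
  refine one_ne_zero (hsum.symm.trans (sum_sep_eq_zero hC hm hsep hadj hdir
    (fun v w h => ?_) hD hdef fun i hi => ?_))
  -- Lengths remain positive along the line, so no edge becomes shorter.
  · refine neg_nonpos.mp (hbound (-C.len s(v, w)) _ fun t' ht' C' g hpi' => ?_)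
    have h1 := (hprop g hpi').2 s(v, w) h
    have h2 := C'.len_pos _ ((g.mem_edgeSet_iff s(v, w)).mpr h)
    rw [SameType.lenChange] at h1
    linarith
  -- The monomials maximal at `x₁` or `x₂` stay maximal along the line, so they maximize the linear
  -- form given by the displacement among all exponents.
  · refine exists_standardDir (l := l) (M := maximizers l a (C.ev i))
      (fun m hm => (mem_maximizers.mp hm).1) (ev_mem i hi) fun m hm m' hm' => ?_
    refine sub_nonpos.mp (hbound (monomialValue a (C.ev i) m' - monomialValue a (C.ev i) m) _
      fun t' ht' C' g hpi' => ?_)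
    have h1 : ∀ j, C'.ev i j = C.ev i j + (t' - t) * D (C.mark i) j := by
      intro j
      rw [← (hprop g hpi').1, SameType.displacement, ← g.mark_eq]
      simp only [PlaneTropicalCurve.ev]
      ring
    rw [g.maximizers_eq i hi] at hm
    have h2 := (mem_maximizers.mp hm).2 m' hm'
    simp only [monomialValue, h1] at h2 ⊢
    linarith

/-! ### Finiteness of the number of combinatorial types -/

/-- Combinatorial types of curves with vertices `0, …, N - 1`. -/
abbrev CombType (n l N B : ℕ) : Type :=
  (Fin N → Fin N → Prop) × (Fin N → Fin N → Fin 2 → Finset.Icc (-(B : ℤ)) B) ×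
    (Fin n → Fin N) × (Fin n → (exponents l).powerset)

theorem abs_dir_le_degree (C : Domain d n hn l a) {v w : C.V} (h : C.graph.Adj v w) (j : Fin 2) :
    |C.dir v w j| ≤ (3 * d : ℕ) := by
  rw [← C.card_ends]
  exact C.abs_dir_le C.isStandardDir h j

open Classical in
/-- The combinatorial type of a curve, for an enumeration of its vertices. -/
noncomputable def combType (C : Domain d n hn l a) {N : ℕ} (f : C.V ≃ Fin N) :
    CombType n l N (3 * d) :=
  (fun x y => C.graph.Adj (f.symm x) (f.symm y),
    fun x y j => if h : C.graph.Adj (f.symm x) (f.symm y) then ⟨C.dir (f.symm x) (f.symm y) j,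
      Finset.mem_Icc.mpr (abs_le.mp (C.abs_dir_le_degree h j))⟩
      -- Off the edges `dir` has no meaning and no bound, so a default value is recorded.
      else ⟨0, by simp⟩,
    fun i => f (C.mark i),
    fun i => ⟨maximizers l a (C.ev i),
      Finset.mem_powerset.mpr fun _ hm => (mem_maximizers.mp hm).1⟩)

theorem nonempty_sameType {N : ℕ} {f : C.V ≃ Fin N} {f' : C'.V ≃ Fin N}
    (h : C.combType f = C'.combType f') : Nonempty (SameType C C') := by
  classical
  simp only [combType, Prod.mk.injEq] at h
  obtain ⟨h1, h2, h3, h4⟩ := h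
  have hadj : ∀ v w, C'.graph.Adj (f'.symm (f v)) (f'.symm (f w)) ↔ C.graph.Adj v w := by
    intro v w
    have := congrFun (congrFun h1 (f v)) (f w)
    simp only [Equiv.symm_apply_apply] at this
    exact this.symm.to_iff
  refine ⟨⟨f.trans f'.symm, hadj, fun v w hvw => funext fun j => ?_, fun i => ?_, fun i _ => ?_⟩⟩
  · have h5 := congrArg Subtype.val (congrFun (congrFun (congrFun h2 (f v)) (f w)) j)
    rw [dif_pos (by simpa using hvw), dif_pos ((hadj v w).mpr hvw)] at h5
    simpa using h5.symm
  · have h5 := congrFun h3 i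
    simp only [Equiv.trans_apply, h5, Equiv.symm_apply_apply]
  · exact congrArg Subtype.val (congrFun h4 i)

/-- The matrix is square, with two columns for the root and one for each edge; a tree has one vertex
more than edges. This makes the number of vertices the same for all curves considered. -/
theorem card_vertices (hm : C.mult ≠ 0) : Fintype.card C.V = Fintype.card (Row n) - 1 := by
  classical
  have h1 := C.card_of_mult_ne_zero hm
  have h2 := C.isTree.card_edgeFinset
  rw [SimpleGraph.edgeFinset_card] at h2
  rw [h1, Fintype.card_sum, Fintype.card_fin, ← h2]
  omega

end Domain

end PlaneTropical

theorem mainTheorem6 (d l : ℕ) (hd : 2 ≤ d) (hl : 1 ≤ l) (a : ℕ × ℕ → ℝ)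
    (p : PlaneTropical.PointMarking (3 * d) → Fin 2 → ℝ) :
    ∃ R : ℝ, ∀ (t : ℝ) (ht : 0 < t), R < t →
      ∀ C : PlaneTropical.Domain d (3 * d) (by omega) l a,
        C.piTilde = (p, PlaneTropical.M4.A t ht) → C.IsGeneral → C.mult ≠ 0 →
          C.FirstTwoAdjacent ∨ C.DecomposesUniquely := by
  by_contra hcon
  push Not at hcon
  choose t ht hlt C hpi hgen hm hadj hdec using fun N : ℕ => hcon N
  have hpi2 : ∀ N, (C N).piTilde.2 = PlaneTropical.M4.A (t N) (ht N) := fun N =>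
    congrArg Prod.snd (hpi N)
  -- A contracted bounded edge in a counterexample would yield (b).
  have hdir : ∀ N v w, (C N).graph.Adj v w → (C N).dir v w ≠ 0 := fun N v w hvw h0 =>
    hdec N (PlaneTropical.Domain.decomposesUniquely (hgen N).1 (hm N)
      (PlaneTropical.Domain.exists_sep (hpi2 N)) (hadj N) ⟨v, w, hvw, h0⟩)
  -- Infinitely many counterexamples share one type. There `t N` is bounded by `R`, although `N < t
  -- N` for arbitrarily large `N`.
  obtain ⟨y, hy⟩ := Finite.exists_infinite_fiber fun N =>
    (C N).combType (Fintype.equivFinOfCardEq (PlaneTropical.Domain.card_vertices (hm N)))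
  obtain ⟨N₀, hN₀⟩ := Set.infinite_coe_iff.mp hy |>.nonempty
  obtain ⟨R, hR⟩ := PlaneTropical.Domain.exists_bound_of_sameType (hgen N₀).1 (hm N₀) (hadj N₀)
    (hdir N₀) (hpi2 N₀)
  obtain ⟨k, hk⟩ := exists_nat_gt R
  obtain ⟨N, hN, hkN⟩ := (Set.infinite_coe_iff.mp hy).exists_gt k
  have h1 := hR (t N) (ht N) (C N)
    (PlaneTropical.Domain.nonempty_sameType (Eq.trans hN₀ (Eq.symm hN)))
    ((hpi N).trans (Prod.ext (congrArg Prod.fst (hpi N₀)).symm rfl))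
  have h2 : (k : ℝ) < N := by exact_mod_cast hkN
  linarith [hlt N]
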